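/- Let $\Omega_0\subset\mathbb R^2$ be a non-empty open convex set that contains no line, and let $\Omega_1\subset\mathbb R^2$ be an open convex set with $\operatorname{cl}\Omega_1\subset\Omega_0$. Assume that (1) neither $\partial\Omega_0$ nor $\partial\Omega_1$ contains a (nondegenerate) linear segment; (2) $\Omega_0$ is unbounded, and every ray contained in $\Omega_0$ can be translated so that it lies entirely in $\Omega_1$. Put $\Omega=\operatorname{cl}(\Omega_0\setminus\Omega_1)$. For a bounded nondegenerate interval $I\subset\mathbb R$ write $\langle\varphi\rangle_J=\frac1{|J|}\int_J\varphi$ and let $\boldsymbol A_\Omega(I)$ be the class of $\varphi\in L^1(I,\mathbb R^2)$ with values in the fixed boundary $\partial\Omega_0$ and such that $\langle\varphi\rangle_J\notin\Omega_1$ for every subinterval $J\subset I$. There is a line $\ell$ such that the orthogonal projection to $\ell$ is injective on $\partial\Omega_0$. Given any such $\ell$ and any orientation of it, call a function with values in $\partial\Omega_0$ non-decreasing if its composition with the projection to $\ell$ is non-decreasing. A non-decreasing rearrangement, on a bounded interval $I^*$ (for instance $I^*=I$ or $I^*=[0,1]$), of a measurable function $\varphi\colon I\to\partial\Omega_0$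 is a function $\varphi^*\colon I^*\to\partial\Omega_0$ that is non-decreasing (on the interior of $I^*$) and has the same distribution as $\varphi$ with respect to the normalized Lebesgue measures of $I^*$ and $I$. Then every $\varphi\in\boldsymbol A_\Omega(I)$ has a non-decreasing rearrangement $\varphi^*$ on $I^*$, and every such $\varphi^*$ belongs to $\boldsymbol A_\Omega(I^*)$. In particular, let $I,I^*$ be bounded nondegenerate intervals. Every real measurable function on $I$ has a non-decreasing and a non-increasing rearrangement on $I^*$ (in the same sense). In what follows $\psi$ and $w$ are functions on $I$, $w$ is measurable and positive almost everywhere, $\psi^*$, $w^*$ denote non-decreasing or non-increasing rearrangements on $I^*$, and suprema are over all subintervals $J$ of the interval in question. (a) BMO. For every $\varepsilon>0$: if $\psi,\psi^2\in L^1(I)$ and $\langle(\psi-\langle\psi\rangle_J)^2\rangle_J\le\varepsilon^2$ for all $J\subset I$, then $\psi^*$ has the same properties on $I^*$. (b) Muckenhoupt constants. For $1<p<\infty$ let $[w]_{A_p}=\sup_J\langle w\rangle_J\,\langle w^{-1/(p-1)}\rangle_J^{\,p-1}$, let $[w]_{A_1}=\sup_J\langle w\rangle_J/\operatorname{ess\,inf}_Jw$,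 and, if $w,\log w\in L^1(I)$, let $[w]_{A_\infty}=\sup_J\langle w\rangle_J\exp(-\langle\log w\rangle_J)$. Then $[w^*]_{A_p}\le[w]_{A_p}$ for all $1\le p<\infty$, and $[w^*]_{A_\infty}\le[w]_{A_\infty}$ if $w,\log w\in L^1(I)$ (values in $[0,+\infty]$). (c) Gehring constants. For $q>1$ and $w\in L^1(I)$ let $[w]_{G_q}=\sup_J\langle w^q\rangle_J^{1/q}\,\langle w\rangle_J^{-1}\in[0,+\infty]$. Then $[w^*]_{G_q}\le[w]_{G_q}$. -/

import Mathlib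

open Set MeasureTheory
open scoped ENNReal

noncomputable section

/-- The Euclidean plane. -/
abbrev Plane := EuclideanSpace ℝ (Fin 2)

/-- Standing assumptions on the pair of convex sets that determines the domain
`Ω = closure (Ω₀ \ Ω₁)`. -/
structure IsConvexPair (Ω₀ Ω₁ : Set Plane) : Prop where
  nonempty : Ω₀.Nonempty
  isOpen_outer : IsOpen Ω₀
  convex_outer : Convex ℝ Ω₀
  no_line : ∀ x u : Plane, u ≠ 0 → ¬ ∀ t : ℝ, x + t • u ∈ Ω₀
  isOpen_inner : IsOpen Ω₁
  convex_inner : Convex ℝ Ω₁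
  closure_subset : closure Ω₁ ⊆ Ω₀

/-- Neither of the two boundaries contains a nondegenerate linear segment. -/
def NoSegmentCondition (Ω₀ Ω₁ : Set Plane) : Prop :=
  ∀ x y : Plane, x ≠ y →
    ¬ segment ℝ x y ⊆ frontier Ω₀ ∧ ¬ segment ℝ x y ⊆ frontier Ω₁

/-- `Ω₀` is unbounded and every ray inside `Ω₀` has a translate inside `Ω₁`. -/
def RayCondition (Ω₀ Ω₁ : Set Plane) : Prop :=
  ¬ Bornology.IsBounded Ω₀ ∧
    ∀ x u : Plane, u ≠ 0 → (∀ t : ℝ, 0 ≤ t → x + t • u ∈ Ω₀) →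
      ∃ y : Plane, ∀ t : ℝ, 0 ≤ t → y + t • u ∈ Ω₁

/-- The class of summable functions on the interval `(a, b)` with values (almost everywhere) in the
boundary of `Ω₀`, none of whose averages over subintervals lies in `Ω₁`. -/
def analyticClass (Ω₀ Ω₁ : Set Plane) (a b : ℝ) : Set (ℝ → Plane) :=
  {φ | IntegrableOn φ (Ioo a b) ∧
    (∀ᵐ t ∂volume.restrict (Ioo a b), φ t ∈ frontier Ω₀) ∧
    ∀ c d : ℝ, a ≤ c → c < d → d ≤ b → (⨍ t in Ioo c d, φ t) ∉ Ω₁}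

/-- The orthogonal projection to the line spanned by `v` is one-to-one on the boundary of `Ω₀`, so
that `x ↦ ⟪v, x⟫` parametrizes and orders this boundary (`-v` gives the opposite order). -/
def IsParametrizingDirection (Ω₀ : Set Plane) (v : Plane) : Prop :=
  InjOn (fun x : Plane => inner ℝ v x) (frontier Ω₀)

/-- `φs`, on the interval `(c, d)`, is a non-decreasing rearrangement of the function `φ` on the
interval `(a, b)`: it takes values in `S`, is non-decreasing in the coordinate `π` on `S`, and has
the same distribution as `φ` with respect to the normalized Lebesgue measures.
Open intervals are used because a monotone function may be unbounded at the endpoints. -/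
structure IsRearrangement {X : Type*} [MeasurableSpace X] (S : Set X) (π : X → ℝ)
    (a b : ℝ) (φ : ℝ → X) (c d : ℝ) (φs : ℝ → X) : Prop where
  mapsTo : MapsTo φs (Ioo c d) S
  monotoneOn : MonotoneOn (fun t => π (φs t)) (Ioo c d)
  identDistrib : ProbabilityTheory.IdentDistrib φs φ
    (ProbabilityTheory.cond volume (Ioo c d)) (ProbabilityTheory.cond volume (Ioo a b))

/-- Non-decreasing rearrangement along the boundary of `Ω₀`, ordered by the direction `v`. -/
def IsBoundaryRearrangement (Ω₀ : Set Plane) (v : Plane)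
    (a b : ℝ) (φ : ℝ → Plane) (c d : ℝ) (φs : ℝ → Plane) : Prop :=
  IsRearrangement (frontier Ω₀) (fun x => inner ℝ v x) a b φ c d φs

/-- Non-decreasing rearrangement of a real function. -/
def IsNondecreasingRearrangement (a b : ℝ) (ψ : ℝ → ℝ) (c d : ℝ) (ψs : ℝ → ℝ) : Prop :=
  IsRearrangement univ (fun x : ℝ => x) a b ψ c d ψs

/-- Non-increasing rearrangement of a real function. -/
def IsNonincreasingRearrangement (a b : ℝ) (ψ : ℝ → ℝ) (c d : ℝ) (ψs : ℝ → ℝ) : Prop :=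
  IsRearrangement univ (fun x : ℝ => -x) a b ψ c d ψs

/-- Monotone rearrangement of a real function (in either direction). -/
def IsMonotoneRearrangement (a b : ℝ) (ψ : ℝ → ℝ) (c d : ℝ) (ψs : ℝ → ℝ) : Prop :=
  IsNondecreasingRearrangement a b ψ c d ψs ∨ IsNonincreasingRearrangement a b ψ c d ψs

/-- The ball of radius `ε` of `BMO` on `(a, b)`, with the quadratic seminorm. -/
def bmoBall (ε a b : ℝ) : Set (ℝ → ℝ) :=
  {ψ | IntegrableOn ψ (Ioo a b) ∧ IntegrableOn (fun t => ψ t ^ 2) (Ioo a b) ∧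
    ∀ c d : ℝ, a ≤ c → c < d → d ≤ b →
      (⨍ t in Ioo c d, (ψ t - ⨍ s in Ioo c d, ψ s) ^ 2) ≤ ε ^ 2}

/-- A weight on `(a, b)`: a measurable, almost everywhere positive function. -/
def IsWeight (a b : ℝ) (w : ℝ → ℝ) : Prop :=
  AEMeasurable w (volume.restrict (Ioo a b)) ∧ ∀ᵐ t ∂volume.restrict (Ioo a b), 0 < w t

/-- The constant `sup_J ⟨w ^ p₁⟩_J ^ (1 / p₁) * ⟨w ^ p₂⟩_J ^ (-1 / p₂)` of a weight `w`, where `J`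
runs through the subintervals of `(a, b)`. -/
def powerConstant (p₁ p₂ a b : ℝ) (w : ℝ → ℝ) : ℝ≥0∞ :=
  ⨆ (c : ℝ) (d : ℝ) (_ : a ≤ c ∧ c < d ∧ d ≤ b),
    (⨍⁻ t in Ioo c d, ENNReal.ofReal (w t ^ p₁) ∂volume) ^ (1 / p₁) *
      (⨍⁻ t in Ioo c d, ENNReal.ofReal (w t ^ p₂) ∂volume) ^ (-1 / p₂)

/-- The Muckenhoupt `A_p` constant, `1 < p < ∞`:
`sup_J ⟨w⟩_J * ⟨w ^ (-1 / (p - 1))⟩_J ^ (p - 1)`. -/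
def muckenhouptConstant (p a b : ℝ) (w : ℝ → ℝ) : ℝ≥0∞ :=
  powerConstant 1 (-1 / (p - 1)) a b w

/-- The Muckenhoupt `A_1` constant `sup_J ⟨w⟩_J / essinf_J w`. -/
def muckenhouptConstantOne (a b : ℝ) (w : ℝ → ℝ) : ℝ≥0∞ :=
  ⨆ (c : ℝ) (d : ℝ) (_ : a ≤ c ∧ c < d ∧ d ≤ b),
    (⨍⁻ t in Ioo c d, ENNReal.ofReal (w t) ∂volume) *
      (essInf (fun t => ENNReal.ofReal (w t)) (volume.restrict (Ioo c d)))⁻¹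

/-- The Muckenhoupt `A_∞` constant in Hruschev's form, `sup_J ⟨w⟩_J * exp (-⟨log w⟩_J)`; it is used
only for weights `w` such that both `w` and `log w` are summable. -/
def muckenhouptConstantTop (a b : ℝ) (w : ℝ → ℝ) : ℝ≥0∞ :=
  ⨆ (c : ℝ) (d : ℝ) (_ : a ≤ c ∧ c < d ∧ d ≤ b),
    ENNReal.ofReal ((⨍ t in Ioo c d, w t) * Real.exp (-⨍ t in Ioo c d, Real.log (w t)))

/-- The Gehring (reverse Hölder) constant with exponent `q > 1`,
`sup_J ⟨w ^ q⟩_J ^ (1 / q) / ⟨w⟩_J`; it is used only for summable weights. -/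
def gehringConstant (q a b : ℝ) (w : ℝ → ℝ) : ℝ≥0∞ :=
  powerConstant q 1 a b w

end

/-! Since `Ω₀` is unbounded, it has a recession direction `u`. As `Ω₀` contains no line and its
boundary no segment, that boundary is the graph of a convex function `h` over an open interval `D`,
in coordinates with `u` vertical. By the ray condition `Ω₁` also recedes along `u`, hence is closed
upwards. A monotone order of the boundary is a monotone order of the abscissa, so everything reduces
to a real function `f`, a monotone rearrangement `fs` and a convex `h`: if the averages of `fs` and
`h ∘ fs` over some interval `J` form a point of an open upward closed set `U`, the averages of `f`
and `h ∘ f` over some interval must do so too (`exists_interval_average_mem`).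

Let `(m, y)` be the point given by `J`. A rising sun lemma for `f - m` gives an open set `E` on each
component of which `f` has average `m`, while off `E` the sign of `f - m` is constant. It suffices
that the average of `h ∘ f` over `E` is at least `y`: some component then has average at least `y`,
and its point lies above `(m, y)`.

Monotonicity makes `J` essentially the set where `fs` lies between two values `p < m < q`. If `J`
has at most the normalized measure of `E`, subtract from `h` its chord over `[p, q]`; otherwise
subtract the broken line through the graph points at `p`, `m`, `q`. The difference is nonpositive on
`[p, q]` and nonnegative off it, so its integral over `J` is the least possible for the common
distribution (`setIntegral_comp_le_of_identDistrib`). The broken line also requires comparing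
positive parts of `f - m` and `fs - m`, which the constant sign off `E` supplies
(`mul_le_setIntegral_convex_comp`).

The real-variable results follow with `h` equal to a square, a power, `-log`, or, for `A_1`, a
truncation `max (B - x) 0`. -/

noncomputable section

open ProbabilityTheory Filter Topology

/-! ### Chords and supporting lines of convex functions. -/

/-- The line through `(p, h p)` and `(q, h q)`, as a function. -/
def chordLine (h : ℝ → ℝ) (p q x : ℝ) : ℝ := h p + (h q - h p) / (q - p) * (x - p)

theorem ConvexOn.le_chordLine {D : Set ℝ} {h : ℝ → ℝ} (hh : ConvexOn ℝ D h) {p q x : ℝ}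
    (hp : p ∈ D) (hq : q ∈ D) (hpq : p < q) (hx : x ∈ Icc p q) : h x ≤ chordLine h p q x := by
  unfold chordLine
  rcases hx.1.eq_or_lt with rfl | h1
  · simp
  rcases hx.2.eq_or_lt with rfl | h2
  · have : x - p ≠ 0 := by linarith
    field_simp; linarith
  have := hh.secant_mono_aux2 hp hq h1 h2
  rw [div_le_iff₀ (by linarith)] at this
  linarith

theorem ConvexOn.chordLine_le {D : Set ℝ} {h : ℝ → ℝ} (hh : ConvexOn ℝ D h) {p q x : ℝ}
    (hp : p ∈ D) (hq : q ∈ D) (hpq : p < q) (hxD : x ∈ D) (hx : x ∉ Ioo p q) :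
    chordLine h p q x ≤ h x := by
  unfold chordLine
  by_cases h1 : x ≤ p
  · rcases h1.eq_or_lt with rfl | h1
    · simp
    have := hh.slope_mono_adjacent hxD hq h1 hpq
    rw [div_le_iff₀ (by linarith)] at this
    linarith
  · push Not at h1
    have h2 : q ≤ x := by
      by_contra h2
      exact hx ⟨h1, not_le.1 h2⟩
    rcases h2.eq_or_lt with rfl | h2
    · have : q - p ≠ 0 := by linarith
      field_simp; linarith
    have := hh.secant_mono_aux2 hp hxD hpq h2
    rw [le_div_iff₀ (by linarith)] at this
    linarith

/-- A convex function on the line has a supporting line at an interior point. -/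
theorem ConvexOn.exists_supporting_slope {D : Set ℝ} {h : ℝ → ℝ} (hh : ConvexOn ℝ D h) {p m q : ℝ}
    (hp : p ∈ D) (hq : q ∈ D) (hpm : p < m) (hmq : m < q) :
    ∃ k : ℝ, ∀ x ∈ D, h m + k * (x - m) ≤ h x := by
  have hm : m ∈ D := hh.1.ordConnected.out hp hq ⟨hpm.le, hmq.le⟩
  set S : Set ℝ := (fun x => (h m - h x) / (m - x)) '' {x | x ∈ D ∧ x < m}
  have hub : ∀ y ∈ D, m < y → ∀ s ∈ S, s ≤ (h y - h m) / (y - m) := by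
    rintro y hy hmy s ⟨x, ⟨hx, hxm⟩, rfl⟩
    exact hh.slope_mono_adjacent hx hy hxm hmy
  have hne : S.Nonempty := ⟨_, p, ⟨hp, hpm⟩, rfl⟩
  -- The slope is the left derivative at `m`: the supremum of the slopes from the left, which every
  -- slope to the right bounds.
  refine ⟨sSup S, fun x hx => ?_⟩
  rcases lt_trichotomy x m with hxm | rfl | hxm
  · have : (h m - h x) / (m - x) ≤ sSup S := le_csSup ⟨_, hub q hq hmq⟩ ⟨x, ⟨hx, hxm⟩, rfl⟩
    rw [div_le_iff₀ (by linarith)] at this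
    linarith
  · simp
  · have : sSup S ≤ (h x - h m) / (x - m) := csSup_le hne (hub x hx hxm)
    rw [le_div_iff₀ (by linarith)] at this
    linarith

/-! ### Integrals of equidistributed functions over subsets. -/

section Comparison

variable {X Y : Type*} [MeasurableSpace X] [MeasurableSpace Y] {P : Measure X} {Q : Measure Y}
  {f : X → ℝ} {g : Y → ℝ}

/-- If `F ∘ g` is nonpositive exactly on `J`, then among the integrals of `F` over
subdistributions of the common distribution of `f` and `g` the one over `J` is the least. -/
theorem setIntegral_comp_le_of_identDistrib (hid : IdentDistrib g f Q P) {F : ℝ → ℝ}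
    (hF : Measurable F) (hint : Integrable (fun x => F (f x)) P) {E : Set X} {J : Set Y}
    (hE : MeasurableSet E) (hJ : MeasurableSet J)
    (hin : ∀ᵐ y ∂Q, y ∈ J → F (g y) ≤ 0) (hout : ∀ᵐ y ∂Q, y ∉ J → 0 ≤ F (g y)) :
    ∫ y in J, F (g y) ∂Q ≤ ∫ x in E, F (f x) ∂P := by
  -- The integral of `min (F ·) 0` depends on the distribution only. It equals the integral over `J`
  -- and is a lower bound for the integral over any `E`.
  have hm : Measurable fun t => min (F t) 0 := hF.min measurable_const
  have hint' : Integrable (fun x => min (F (f x)) 0) P := hint.inf (integrable_zero _ _ _)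
  calc ∫ y in J, F (g y) ∂Q = ∫ y, min (F (g y)) 0 ∂Q := by
        rw [← integral_indicator hJ]
        apply integral_congr_ae
        filter_upwards [hin, hout] with y h1 h2
        by_cases hy : y ∈ J
        · simp [hy, h1 hy]
        · simp [hy, h2 hy]
    _ = ∫ x, min (F (f x)) 0 ∂P := (hid.comp hm).integral_eq
    _ ≤ ∫ x in E, min (F (f x)) 0 ∂P := by
        rw [← integral_indicator hE]
        refine integral_mono hint' (hint'.indicator hE) fun x => ?_
        by_cases hx : x ∈ E <;> simp [hx]
    _ ≤ ∫ x in E, F (f x) ∂P :=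
        setIntegral_mono hint'.integrableOn hint.integrableOn fun x => min_le_left _ _

variable [IsProbabilityMeasure P]

theorem setIntegral_affine_of_setIntegral_sub_eq_zero (hf : Integrable f P) {E : Set X} {m : ℝ}
    (hEm : ∫ x in E, (f x - m) ∂P = 0) (u s : ℝ) :
    ∫ x in E, (u + s * (f x - m)) ∂P = P.real E * u := by
  have h1 : IntegrableOn (fun x => s * (f x - m)) E P :=
    ((hf.sub (integrable_const m)).const_mul s).integrableOn
  rw [integral_add (integrable_const _).integrableOn h1, integral_const_mul, hEm]
  simp

/-- If `J` is cut out by an interval of values of `g`, while the integral of `(f - m)⁺` over `E` is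
not less than the one of `(g - m)⁺` over `J`, where `m` is the common average, then the average of
`h ∘ f` over `E` is at least the average `y` of `h ∘ g` over `J`, for every convex `h`. -/
theorem mul_le_setIntegral_convex_comp [IsProbabilityMeasure Q] (hid : IdentDistrib g f Q P)
    {D : Set ℝ} {h : ℝ → ℝ}
    (hh : ConvexOn ℝ D h) (hmeas : Measurable h) (hfD : ∀ᵐ y ∂Q, g y ∈ D)
    (hf : Integrable f P) (hhf : Integrable (fun x => h (f x)) P)
    {E : Set X} {J : Set Y} (hE : MeasurableSet E) (hJ : MeasurableSet J)
    {p m q y : ℝ} (hp : p ∈ D) (hq : q ∈ D) (hpm : p < m) (hmq : m < q)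
    (hin : ∀ᵐ t ∂Q, t ∈ J → g t ∈ Icc p q) (hout : ∀ᵐ t ∂Q, t ∉ J → g t ∉ Ioo p q)
    (hEm : ∫ x in E, (f x - m) ∂P = 0) (hJm : ∫ t in J, (g t - m) ∂Q = 0)
    (hpos : ∫ t in J, max (g t - m) 0 ∂Q ≤ ∫ x in E, max (f x - m) 0 ∂P)
    (hJ0 : 0 < Q.real J) (hy : ∫ t in J, h (g t) ∂Q = Q.real J * y) :
    P.real E * y ≤ ∫ x in E, h (f x) ∂P := by
  have hm : m ∈ D := hh.1.ordConnected.out hp hq ⟨hpm.le, hmq.le⟩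
  have hg : Integrable g Q := hid.integrable_iff.2 hf
  have hhg : Integrable (fun t => h (g t)) Q := (hid.comp hmeas).integrable_iff.2 hhf
  have hfm : Integrable (fun x => max (f x - m) 0) P :=
    (hf.sub (integrable_const m)).sup (integrable_zero _ _ _)
  have hgm : Integrable (fun x => max (g x - m) 0) Q :=
    (hg.sub (integrable_const m)).sup (integrable_zero _ _ _)
  have affE : ∀ u s : ℝ, ∫ x in E, (u + s * (f x - m)) ∂P = P.real E * u := fun u s =>
    setIntegral_affine_of_setIntegral_sub_eq_zero hf hEm u s
  have affJ : ∀ u s : ℝ, ∫ x in J, (u + s * (g x - m)) ∂Q = Q.real J * u := fun u s =>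
    setIntegral_affine_of_setIntegral_sub_eq_zero hg hJm u s
  have iaffE : ∀ u s : ℝ, Integrable (fun x => u + s * (f x - m)) P := fun u s =>
    (integrable_const _).add ((hf.sub (integrable_const m)).const_mul s)
  have iaffJ : ∀ u s : ℝ, Integrable (fun x => u + s * (g x - m)) Q := fun u s =>
    (integrable_const _).add ((hg.sub (integrable_const m)).const_mul s)
  have jensen : h m ≤ y := by
    obtain ⟨k, hk⟩ := hh.exists_supporting_slope hp hq hpm hmq
    have h1 : ∫ x in J, (h m + k * (g x - m)) ∂Q ≤ ∫ x in J, h (g x) ∂Q := by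
      apply setIntegral_mono_ae (iaffJ _ _).integrableOn hhg.integrableOn
      filter_upwards [hfD] with x hx using hk _ hx
    rw [affJ, hy] at h1
    exact le_of_mul_le_mul_left h1 hJ0
  rcases le_total (Q.real J) (P.real E) with hle | hle
  -- Small `J`: compare with the chord, whose average over both sets is its value `u` at `m`. Since
  -- `y ≤ u`, the resulting bound `|E| u + |J| (y - u)` is at least `|E| y`.
  · set s := (h q - h p) / (q - p)
    set u := h p + s * (m - p)
    have hL : ∀ x, chordLine h p q x = u + s * (x - m) := by
      intro x; simp only [chordLine, u, s]; ring
    have hFm : Measurable fun x => h x - (u + s * (x - m)) := by fun_prop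
    have hneg : ∀ᵐ t ∂Q, t ∈ J → h (g t) - (u + s * (g t - m)) ≤ 0 := by
      filter_upwards [hin] with t ht htJ
      have := hh.le_chordLine hp hq (hpm.trans hmq) (ht htJ)
      rw [hL] at this; linarith
    have h1 := setIntegral_comp_le_of_identDistrib hid hFm (hhf.sub (iaffE u s)) hE hJ hneg
      (by
        filter_upwards [hout, hfD] with t ht htD htJ
        have := hh.chordLine_le hp hq (hpm.trans hmq) htD (ht htJ)
        rw [hL] at this; linarith)
    have h0 : ∫ t in J, (h (g t) - (u + s * (g t - m))) ∂Q ≤ 0 :=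
      setIntegral_nonpos_ae hJ hneg
    rw [integral_sub hhg.integrableOn (iaffJ _ _).integrableOn, affJ, hy] at h0 h1
    rw [integral_sub hhf.integrableOn (iaffE _ _).integrableOn, affE] at h1
    have h3 : y ≤ u := le_of_mul_le_mul_left (by linarith) hJ0
    nlinarith
  -- Large `J`: compare with the broken line through `p`, `m`, `q`. It is written as an affine
  -- function plus a nonnegative multiple of the positive part, so its integrals are controlled by
  -- `hpos`. Jensen's inequality `h m ≤ y` then replaces `y ≤ u`.
  · set s₀ := (h m - h p) / (m - p)
    set s₁ := (h q - h m) / (q - m)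
    have hs : s₀ ≤ s₁ := hh.slope_mono_adjacent hp hq hpm hmq
    set l : ℝ → ℝ := fun x => (h m + s₀ * (x - m)) + (s₁ - s₀) * max (x - m) 0 with hl
    have hl₀ : ∀ x ≤ m, l x = chordLine h p m x := by
      intro x hx
      have : m - p ≠ 0 := by linarith
      simp only [hl, chordLine, s₀, max_eq_right (sub_nonpos.2 hx)]
      field_simp
      ring
    have hl₁ : ∀ x, m ≤ x → l x = chordLine h m q x := by
      intro x hx
      simp only [hl, chordLine, s₁, max_eq_left (sub_nonneg.2 hx)]
      ring
    have hFm : Measurable fun x => h x - l x := by fun_prop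
    have ilE : Integrable (fun x => l (f x)) P := (iaffE _ _).add (hfm.const_mul _)
    have ilJ : Integrable (fun x => l (g x)) Q := (iaffJ _ _).add (hgm.const_mul _)
    have h1 := setIntegral_comp_le_of_identDistrib hid hFm (hhf.sub ilE) hE hJ
      (by
        filter_upwards [hin] with t ht htJ
        rw [sub_nonpos]
        rcases le_total (g t) m with h | h
        · rw [hl₀ _ h]; exact hh.le_chordLine hp hm hpm ⟨(ht htJ).1, h⟩
        · rw [hl₁ _ h]; exact hh.le_chordLine hm hq hmq ⟨h, (ht htJ).2⟩)
      (by
        filter_upwards [hout, hfD] with t ht htD htJ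
        rw [sub_nonneg]
        rcases le_total (g t) m with h | h
        · rw [hl₀ _ h]
          exact hh.chordLine_le hp hm hpm htD fun h' => ht htJ ⟨h'.1, h'.2.trans hmq⟩
        · rw [hl₁ _ h]
          exact hh.chordLine_le hm hq hmq htD fun h' => ht htJ ⟨hpm.trans h'.1, h'.2⟩)
    rw [integral_sub hhg.integrableOn ilJ.integrableOn, hy,
      integral_sub hhf.integrableOn ilE.integrableOn] at h1
    simp only [hl] at h1
    rw [integral_add (iaffJ _ _).integrableOn (hgm.const_mul _).integrableOn, affJ,
      integral_add (iaffE _ _).integrableOn (hfm.const_mul _).integrableOn, affE,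
      integral_const_mul, integral_const_mul] at h1
    nlinarith [mul_le_mul_of_nonneg_left hpos (sub_nonneg.2 hs),
      mul_le_mul_of_nonneg_right hle (sub_nonneg.2 jensen)]

end Comparison

/-! ### Components of open sets and the rising sun lemma. -/

/-- The pairs of endpoints of the maximal intervals contained in a set of real numbers. -/
def gapEndpoints (U : Set ℝ) : Set (ℝ × ℝ) :=
  {z | z.1 < z.2 ∧ Ioo z.1 z.2 ⊆ U ∧ z.1 ∉ U ∧ z.2 ∉ U}

theorem pairwiseDisjoint_gapEndpoints (U : Set ℝ) :
    (gapEndpoints U).PairwiseDisjoint fun z => Ioo z.1 z.2 := by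
  rintro ⟨p, q⟩ ⟨-, hU, hp, hq⟩ ⟨p', q'⟩ ⟨-, hU', hp', hq'⟩ hne
  refine Set.disjoint_left.2 fun x hx hx' => hne ?_
  simp only [mem_Ioo] at *
  have h1 : p = p' := by
    rcases lt_trichotomy p p' with h | h | h
    · exact absurd (hU ⟨h, hx'.1.trans hx.2⟩) hp'
    · exact h
    · exact absurd (hU' ⟨h, hx.1.trans hx'.2⟩) hp
  have h2 : q = q' := by
    rcases lt_trichotomy q q' with h | h | h
    · exact absurd (hU' ⟨hx'.1.trans hx.2, h⟩) hq
    · exact h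
    · exact absurd (hU ⟨hx.1.trans hx'.2, h⟩) hq'
  rw [h1, h2]

theorem countable_gapEndpoints (U : Set ℝ) : (gapEndpoints U).Countable :=
  (pairwiseDisjoint_gapEndpoints U).countable_of_isOpen (fun _ _ => isOpen_Ioo)
    fun _ hz => nonempty_Ioo.2 hz.1

theorem iUnion_gapEndpoints {U : Set ℝ} (hU : IsOpen U) {a b : ℝ} (hUab : U ⊆ Ioo a b) :
    ⋃ z : gapEndpoints U, Ioo z.1.1 z.1.2 = U := by
  apply Subset.antisymm (iUnion_subset fun z => z.2.2.1)
  intro t ht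
  have hR : (Uᶜ ∩ Ici t).Nonempty := ⟨b, fun h => (hUab h).2.false, (hUab ht).2.le⟩
  have hL : (Uᶜ ∩ Iic t).Nonempty := ⟨a, fun h => (hUab h).1.false, (hUab ht).1.le⟩
  have hRb : BddBelow (Uᶜ ∩ Ici t) := ⟨t, fun _ h => h.2⟩
  have hLb : BddAbove (Uᶜ ∩ Iic t) := ⟨t, fun _ h => h.2⟩
  obtain ⟨hq1, hq2⟩ := (hU.isClosed_compl.inter isClosed_Ici).csInf_mem hR hRb
  obtain ⟨hp1, hp2⟩ := (hU.isClosed_compl.inter isClosed_Iic).csSup_mem hL hLb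
  set q := sInf (Uᶜ ∩ Ici t)
  set p := sSup (Uᶜ ∩ Iic t)
  have hpt : p < t := lt_of_le_of_ne hp2 fun h => hp1 (h ▸ ht)
  have htq : t < q := lt_of_le_of_ne hq2 fun h => hq1 (h ▸ ht)
  refine mem_iUnion.2 ⟨⟨(p, q), hpt.trans htq, fun x hx => ?_, hp1, hq1⟩, hpt, htq⟩
  by_contra hxU
  rcases le_total x t with h | h
  · exact hx.1.not_ge (le_csSup hLb ⟨hxU, h⟩)
  · exact hx.2.not_ge (csInf_le hRb ⟨hxU, h⟩)

theorem hasSum_setIntegral_gapEndpoints {U : Set ℝ} (hU : IsOpen U) {a b : ℝ}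
    (hUab : U ⊆ Ioo a b) {g : ℝ → ℝ} (hg : IntegrableOn g (Ioo a b)) :
    HasSum (fun z : gapEndpoints U => ∫ t in Ioo z.1.1 z.1.2, g t) (∫ t in U, g t) := by
  have : Countable (gapEndpoints U) := (countable_gapEndpoints U).to_subtype
  have h := hasSum_integral_iUnion (μ := volume) (f := g)
    (s := fun z : gapEndpoints U => Ioo z.1.1 z.1.2) (fun _ => measurableSet_Ioo)
    (fun x y hxy => pairwiseDisjoint_gapEndpoints U x.2 y.2 fun h => hxy (Subtype.ext h))
    (by rw [iUnion_gapEndpoints hU hUab]; exact hg.mono_set hUab)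
  rwa [iUnion_gapEndpoints hU hUab] at h

/-- If every maximal interval of an open set has integral zero of `F`, so has the set; and if the
integral of `g` over the set is nonnegative, so is the one over some maximal interval. -/
theorem exists_gapEndpoints_setIntegral_nonneg {U : Set ℝ} (hU : IsOpen U) {a b : ℝ}
    (hUab : U ⊆ Ioo a b) (hne : U.Nonempty) {g : ℝ → ℝ} (hg : IntegrableOn g (Ioo a b))
    (h0 : 0 ≤ ∫ t in U, g t) : ∃ z ∈ gapEndpoints U, 0 ≤ ∫ t in Ioo z.1 z.2, g t := by
  by_contra! hcon
  have hs := hasSum_setIntegral_gapEndpoints hU hUab hg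
  have hz : ∃ z, z ∈ gapEndpoints U := by
    obtain ⟨t, ht⟩ := hne
    rw [← iUnion_gapEndpoints hU hUab, mem_iUnion] at ht
    exact ht.imp' Subtype.val fun z _ => z.2
  obtain ⟨z, hz⟩ := hz
  have h1 : ∫ t in U, g t < 0 := hasSum_lt (i := ⟨z, hz⟩)
    (f := fun z : gapEndpoints U => ∫ t in Ioo z.1.1 z.1.2, g t) (g := fun _ => 0)
    (fun z => (hcon z.1 z.2).le) (hcon z hz) hs hasSum_zero
  exact h1.not_ge h0

theorem mem_Icc_of_gapEndpoints {U : Set ℝ} {a b : ℝ} (hUab : U ⊆ Ioo a b) {z : ℝ × ℝ}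
    (hz : z ∈ gapEndpoints U) : a ≤ z.1 ∧ z.2 ≤ b :=
  (Ioo_subset_Ioo_iff hz.1).1 (hz.2.1.trans hUab)

/-- A version of the rising sun lemma. -/
theorem exists_isOpen_rising_sun_aux {F : ℝ → ℝ} {a b : ℝ} (hab : a < b)
    (hF : IntegrableOn F (Ioo a b)) (hneg : ∫ t in Ioo a b, F t ≤ 0) :
    ∃ E ⊆ Ioo a b, IsOpen E ∧ (∀ᵐ t, t ∈ Ioo a b → t ∉ E → F t ≤ 0) ∧
      ∀ z ∈ gapEndpoints E, ∫ t in Ioo z.1 z.2, F t = 0 := by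
  have hFi : IntervalIntegrable F volume a b := by
    rwa [intervalIntegrable_iff_integrableOn_Ioo_of_le hab.le]
  set G : ℝ → ℝ := fun x => ∫ t in a..x, F t with hG
  have hGc : ContinuousOn G (Icc a b) := by
    have := intervalIntegral.continuousOn_primitive_interval' hFi left_mem_uIcc
    rwa [uIcc_of_le hab.le] at this
  have hGi : ∀ p q, a ≤ p → p ≤ q → q ≤ b → ∫ t in Ioo p q, F t = G q - G p := by
    intro p q hp hpq hq
    rw [← integral_Ioc_eq_integral_Ioo, ← intervalIntegral.integral_of_le hpq, hG]
    have h1 : IntervalIntegrable F volume a p := hFi.mono_set (by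
      rw [uIcc_of_le hp, uIcc_of_le hab.le]; exact Icc_subset_Icc_right (hpq.trans hq))
    have h2 : IntervalIntegrable F volume a q := hFi.mono_set (by
      rw [uIcc_of_le (hp.trans hpq), uIcc_of_le hab.le]; exact Icc_subset_Icc_right hq)
    exact (intervalIntegral.integral_interval_sub_left h2 h1).symm
  have hGa : G a = 0 := by simp [hG]
  have hGb : G b ≤ 0 := by
    have := hGi a b le_rfl hab.le le_rfl
    linarith
  -- the last zero of `G`
  obtain ⟨τ, ⟨hτ, hGτ⟩, hτmax⟩ : ∃ τ, IsGreatest {t | t ∈ Icc a b ∧ G t = 0} τ := by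
    apply IsCompact.exists_isGreatest
    · have := hGc.preimage_isClosed_of_isClosed isClosed_Icc (isClosed_singleton (x := (0 : ℝ)))
      exact isCompact_Icc.of_isClosed_subset this fun x hx => hx.1
    · exact ⟨a, ⟨le_rfl, hab.le⟩, hGa⟩
  have hGle : ∀ t ∈ Icc τ b, G t ≤ 0 := by
    intro t ht
    by_contra! h
    obtain ⟨s, hs, hs0⟩ := intermediate_value_Icc' ht.2
      (hGc.mono (Icc_subset_Icc_left (hτ.1.trans ht.1))) ⟨hGb, h.le⟩
    have : s ≤ τ := hτmax ⟨⟨(hτ.1.trans ht.1).trans hs.1, hs.2⟩, hs0⟩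
    have : t = s := le_antisymm hs.1 (this.trans ht.1)
    rw [this, hs0] at h
    exact h.false
  -- The rising sun set is taken only to the right of `τ`. Started at `a`, its first component would
  -- yield just `G p ≤ G q`; started at `τ`, where `G` vanishes and after which `G ≤ 0`, it yields
  -- equality. The remaining piece `Ioo a τ` has integral zero by the choice of `τ`.
  set U : Set ℝ := {t | t ∈ Ioo τ b ∧ ∃ s ∈ Ioc t b, G t < G s} with hUdef
  have hUo : IsOpen U := by
    have : U = ⋃ s ∈ Icc a b, (Ioo a b ∩ G ⁻¹' (Iio (G s))) ∩ (Ioo τ b ∩ Iio s) := by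
      ext t
      simp only [hUdef, mem_ofPred_eq, mem_iUnion, mem_inter_iff, mem_preimage, mem_Iio, mem_Ioo,
        mem_Ioc, mem_Icc, exists_prop]
      constructor
      · rintro ⟨h1, s, h2, h3⟩
        have := hτ.1
        exact ⟨s, ⟨by linarith, h2.2⟩, ⟨⟨by linarith, h1.2⟩, h3⟩, h1, h2.1⟩
      · rintro ⟨s, h1, ⟨h2, h3⟩, h4, h5⟩
        exact ⟨h4, s, ⟨h5, h1.2⟩, h3⟩
    rw [this]
    refine isOpen_biUnion fun s _ => IsOpen.inter ?_ (isOpen_Ioo.inter isOpen_Iio)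
    exact (hGc.mono Ioo_subset_Icc_self).isOpen_inter_preimage isOpen_Ioo isOpen_Iio
  refine ⟨Ioo a τ ∪ U, ?_, isOpen_Ioo.union hUo, ?_, ?_⟩
  · rintro t (h | h)
    · exact ⟨h.1, h.2.trans_le hτ.2⟩
    · exact ⟨hτ.1.trans_lt h.1.1, h.1.2⟩
  · have hτne : ∀ᵐ t : ℝ, t ≠ τ := by simp [ae_iff, measure_singleton]
    filter_upwards [hFi.ae_hasDerivAt_integral, hτne] with t hd htτ ht htE
    rw [uIcc_of_le hab.le] at hd
    have hd := (hd ⟨ht.1.le, ht.2.le⟩ a ⟨le_rfl, hab.le⟩)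
    have hτt : τ < t := by
      by_contra! h
      exact htE (Or.inl ⟨ht.1, lt_of_le_of_ne h htτ⟩)
    -- Off `E` no later value of `G` is larger, so the right difference quotients, which tend to `F
    -- t` almost everywhere, are nonpositive.
    have hmax : ∀ s ∈ Ioc t b, G s ≤ G t := by
      intro s hs
      by_contra! h
      exact htE (Or.inr ⟨⟨hτt, ht.2⟩, s, hs, h⟩)
    have hlim := (hasDerivAt_iff_tendsto_slope.1 hd).mono_left
      (nhdsWithin_mono t (show Ioi t ⊆ {t}ᶜ from fun x hx => ne_of_gt hx))
    refine le_of_tendsto hlim ?_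
    filter_upwards [Ioc_mem_nhdsGT ht.2] with s hs
    rw [slope_def_field]
    exact div_nonpos_of_nonpos_of_nonneg (sub_nonpos.2 (hmax s hs)) (sub_nonneg.2 hs.1.le)
  · rintro ⟨p, q⟩ ⟨hpq, hsub, hp, hq⟩
    dsimp only at *
    have hEab : Ioo a τ ∪ U ⊆ Ioo a b := by
      rintro t (h | h)
      · exact ⟨h.1, h.2.trans_le hτ.2⟩
      · exact ⟨hτ.1.trans_lt h.1.1, h.1.2⟩
    obtain ⟨hap, hqb⟩ := (Ioo_subset_Ioo_iff hpq).1 (hsub.trans hEab)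
    have hτE : τ ∉ Ioo a τ ∪ U := by
      rintro (h | h)
      · exact h.2.false
      · exact h.1.1.false
    rw [hGi p q hap hpq.le hqb, sub_eq_zero]
    rcases lt_or_ge p τ with hpτ | hpτ
    · have h1 : p = a := by
        by_contra hne
        exact hp (Or.inl ⟨lt_of_le_of_ne hap (Ne.symm hne), hpτ⟩)
      have h2 : q = τ := by
        rcases lt_trichotomy q τ with h | h | h
        · exact absurd (Or.inl ⟨by linarith, h⟩) hq
        · exact h
        · exact absurd (hsub ⟨hpτ, h⟩) hτE
      rw [h1, h2, hGa, hGτ]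
    · have hsubU : Ioo p q ⊆ U := by
        intro t ht
        rcases hsub ht with h | h
        · exact absurd h.2 (hpτ.trans_lt ht.1).not_gt
        · exact h
      apply le_antisymm
      · rcases hpτ.eq_or_lt with rfl | hpτ
        · rw [hGτ]; exact hGle _ ⟨hpq.le, hqb⟩
        · by_contra! h
          exact hp (Or.inr ⟨⟨hpτ, hpq.trans_le hqb⟩, q, ⟨hpq, hqb⟩, h⟩)
      -- A maximum point of `G` on `[t, q]` before `q` would lie in `U`; the later larger value
      -- would fall beyond `q` and put `q` in `U`.
      · have hclaim : ∀ t ∈ Ioo p q, G t ≤ G q := by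
          intro t ht
          obtain ⟨s, hs, hsmax⟩ := isCompact_Icc.exists_isMaxOn (nonempty_Icc.2 ht.2.le)
            (hGc.mono (Icc_subset_Icc (hap.trans ht.1.le) hqb))
          rcases hs.2.eq_or_lt with rfl | hsq
          · exact hsmax ⟨le_rfl, ht.2.le⟩
          exfalso
          obtain ⟨-, s', hs', hlt⟩ := hsubU ⟨ht.1.trans_le hs.1, hsq⟩
          rcases le_or_gt s' q with h | h
          · exact (hsmax (show s' ∈ Icc t q from ⟨hs.1.trans hs'.1.le, h⟩)).not_gt hlt
          · refine hq (Or.inr ⟨⟨hpτ.trans_lt hpq, h.trans_le hs'.2⟩, s', ⟨h, hs'.2⟩, ?_⟩)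
            exact (hsmax (show q ∈ Icc t q from ⟨ht.2.le, le_rfl⟩)).trans_lt hlt
        have hcw : Tendsto G (𝓝[Ioo p q] p) (𝓝 (G p)) :=
          ((hGc p ⟨hap, hpq.le.trans hqb⟩).mono
            ((Ioo_subset_Ioo hap hqb).trans Ioo_subset_Icc_self))
        have : (𝓝[Ioo p q] p).NeBot := left_nhdsWithin_Ioo_neBot hpq
        exact le_of_tendsto hcw (eventually_mem_nhdsWithin.mono hclaim)

/-- The sign of the total integral decides whether to apply the previous lemma to `F` or to `-F`,
hence which sign remains off `E`. -/
theorem exists_isOpen_rising_sun {F : ℝ → ℝ} {a b : ℝ} (hab : a < b)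
    (hF : IntegrableOn F (Ioo a b)) :
    ∃ E ⊆ Ioo a b, IsOpen E ∧ ((∀ᵐ t, t ∈ Ioo a b → t ∉ E → F t ≤ 0) ∨
      (∀ᵐ t, t ∈ Ioo a b → t ∉ E → 0 ≤ F t)) ∧
      ∀ z ∈ gapEndpoints E, ∫ t in Ioo z.1 z.2, F t = 0 := by
  rcases le_total (∫ t in Ioo a b, F t) 0 with h | h
  · obtain ⟨E, h1, h2, h3, h4⟩ := exists_isOpen_rising_sun_aux hab hF h
    exact ⟨E, h1, h2, Or.inl h3, h4⟩
  · obtain ⟨E, h1, h2, h3, h4⟩ := exists_isOpen_rising_sun_aux hab hF.neg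
      (by simpa [integral_neg] using h)
    refine ⟨E, h1, h2, Or.inr (h3.mono fun t h ht htE => by simpa using h ht htE), fun z hz => ?_⟩
    simpa [integral_neg] using h4 z hz

/-! ### Positive parts over the rising sun set. -/

section

section Comparison

variable {X Y : Type*} [MeasurableSpace X] [MeasurableSpace Y] {P : Measure X} {Q : Measure Y}
  {f : X → ℝ} {g : Y → ℝ}

/-- All of the positive part of `f - m` is carried by `E`, and its total integral is that of `g -
m`. -/
theorem setIntegral_posPart_le_of_ae_le_off [IsProbabilityMeasure Q]
    (hid : IdentDistrib g f Q P) (hf : Integrable f P)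
    {E : Set X} {J : Set Y} (hE : MeasurableSet E) {m : ℝ}
    (hoff : ∀ᵐ x ∂P, x ∉ E → f x ≤ m) :
    ∫ t in J, max (g t - m) 0 ∂Q ≤ ∫ x in E, max (f x - m) 0 ∂P := by
  have hg : Integrable g Q := hid.integrable_iff.2 hf
  have hmeas : Measurable fun x : ℝ => max (x - m) 0 :=
    (measurable_id.sub_const m).max measurable_const
  have hgm : Integrable (fun x => max (g x - m) 0) Q :=
    (hg.sub (integrable_const m)).sup (integrable_zero _ _ _)
  calc ∫ t in J, max (g t - m) 0 ∂Q ≤ ∫ t, max (g t - m) 0 ∂Q :=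
        setIntegral_le_integral hgm (ae_of_all _ fun _ => le_max_right _ _)
    _ = ∫ x, max (f x - m) 0 ∂P := (hid.comp hmeas).integral_eq
    _ = ∫ x in E, max (f x - m) 0 ∂P := by
        rw [← integral_indicator hE]
        apply integral_congr_ae
        filter_upwards [hoff] with x hx
        by_cases hxE : x ∈ E
        · simp [hxE]
        · simp [hxE, hx hxE]

variable [IsProbabilityMeasure P]

theorem setIntegral_posPart_eq_of_setIntegral_sub_eq_zero (hf : Integrable f P) {E : Set X} {m : ℝ}
    (hEm : ∫ x in E, (f x - m) ∂P = 0) :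
    ∫ x in E, max (-f x - -m) 0 ∂P = ∫ x in E, max (f x - m) 0 ∂P := by
  have h1 : Integrable (fun x => f x - m) P := hf.sub (integrable_const m)
  have h2 : Integrable (fun x => max (f x - m) 0) P := h1.sup (integrable_zero _ _ _)
  calc ∫ x in E, max (-f x - -m) 0 ∂P = ∫ x in E, (max (f x - m) 0 - (f x - m)) ∂P := by
        congr 1 with x
        rcases le_total (f x) m with h | h
        · rw [max_eq_left (by linarith), max_eq_right (by linarith)]; ring
        · rw [max_eq_right (by linarith), max_eq_left (by linarith)]; ring
    _ = _ := by rw [integral_sub h2.integrableOn h1.integrableOn, hEm, sub_zero]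

/-- If instead `m ≤ f` off `E`, the same argument applies to negative parts, whose integrals over
`E` and over `J` equal those of the positive parts because the averages are `m`. -/
theorem setIntegral_posPart_le [IsProbabilityMeasure Q] (hid : IdentDistrib g f Q P)
    (hf : Integrable f P) {E : Set X} {J : Set Y} (hE : MeasurableSet E) {m : ℝ}
    (hEm : ∫ x in E, (f x - m) ∂P = 0) (hJm : ∫ t in J, (g t - m) ∂Q = 0)
    (hoff : (∀ᵐ x ∂P, x ∉ E → f x ≤ m) ∨ (∀ᵐ x ∂P, x ∉ E → m ≤ f x)) :
    ∫ t in J, max (g t - m) 0 ∂Q ≤ ∫ x in E, max (f x - m) 0 ∂P := by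
  rcases hoff with h | h
  · exact setIntegral_posPart_le_of_ae_le_off hid hf hE h
  · have h1 := setIntegral_posPart_le_of_ae_le_off (hid.comp measurable_neg) hf.neg (J := J)
      (m := -m) hE (h.mono fun x hx hxE => by simpa using hx hxE)
    have hg : Integrable g Q := hid.integrable_iff.2 hf
    simp only [Function.comp_apply] at h1
    rwa [setIntegral_posPart_eq_of_setIntegral_sub_eq_zero hf hEm,
      setIntegral_posPart_eq_of_setIntegral_sub_eq_zero hg hJm] at h1

end Comparison

/-! ### Normalized Lebesgue measure and averages over intervals. -/

section Cond

variable {a b : ℝ}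

theorem isProbabilityMeasure_cond_Ioo (hab : a < b) :
    IsProbabilityMeasure (cond volume (Ioo a b)) :=
  cond_isProbabilityMeasure_of_finite (by simp [hab]) (by simp)

theorem integrable_cond_Ioo_iff {E : Type*} [NormedAddCommGroup E] (hab : a < b) {g : ℝ → E} :
    Integrable g (cond volume (Ioo a b)) ↔ IntegrableOn g (Ioo a b) := by
  rw [ProbabilityTheory.cond, integrable_smul_measure (by simp) (by simp [hab])]
  rfl

theorem ae_cond_Ioo_iff {p : ℝ → Prop} :
    (∀ᵐ t ∂cond volume (Ioo a b), p t) ↔ ∀ᵐ t ∂volume.restrict (Ioo a b), p t := by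
  rw [ProbabilityTheory.cond]
  exact Measure.ae_ennreal_smul_measure_iff (by simp)

theorem aemeasurable_cond_Ioo_iff {E : Type*} [MeasurableSpace E] {g : ℝ → E} :
    AEMeasurable g (cond volume (Ioo a b)) ↔ AEMeasurable g (volume.restrict (Ioo a b)) := by
  rw [ProbabilityTheory.cond]
  exact aemeasurable_smul_measure_iff (by simp)

theorem setIntegral_cond_Ioo (hab : a < b) {E : Set ℝ} (hE : MeasurableSet E)
    (hEab : E ⊆ Ioo a b) (g : ℝ → ℝ) :
    ∫ t in E, g t ∂cond volume (Ioo a b) = (b - a)⁻¹ * ∫ t in E, g t := by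
  rw [ProbabilityTheory.cond, Measure.restrict_smul, Measure.restrict_restrict hE,
    inter_eq_left.2 hEab, integral_smul_measure, Real.volume_Ioo, ENNReal.toReal_inv,
    ENNReal.toReal_ofReal (by linarith), smul_eq_mul]

theorem measureReal_cond_Ioo (hab : a < b) {E : Set ℝ} (hE : MeasurableSet E)
    (hEab : E ⊆ Ioo a b) :
    (cond volume (Ioo a b)).real E = (b - a)⁻¹ * volume.real E := by
  have := setIntegral_cond_Ioo hab hE hEab fun _ => 1
  simpa using this

theorem setAverage_Ioo_eq (hab : a < b) (g : ℝ → ℝ) :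
    ⨍ t in Ioo a b, g t = (b - a)⁻¹ * ∫ t in Ioo a b, g t := by
  rw [setAverage_eq, Real.volume_real_Ioo_of_le hab.le, smul_eq_mul]

theorem setAverage_Ioo_eq_primitive {a b c d : ℝ} {g : ℝ → ℝ} (hg : IntegrableOn g (Ioo a b))
    (hac : a ≤ c) (hcd : c < d) (hdb : d ≤ b) :
    ⨍ t in Ioo c d, g t = (d - c)⁻¹ * ((∫ t in a..d, g t) - ∫ t in a..c, g t) := by
  have hi : ∀ x y, a ≤ x → x ≤ y → y ≤ b → IntervalIntegrable g volume x y := by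
    intro x y h1 h2 h3
    rw [intervalIntegrable_iff_integrableOn_Ioo_of_le h2]
    exact hg.mono_set (Ioo_subset_Ioo h1 h3)
  rw [setAverage_Ioo_eq hcd, intervalIntegral.integral_interval_sub_left
    (hi a d le_rfl (hac.trans hcd.le) hdb) (hi a c le_rfl hac (hcd.le.trans hdb)),
    intervalIntegral.integral_of_le hcd.le, integral_Ioc_eq_integral_Ioo]

/-- Averages over intervals shrinking to a Lebesgue point. -/
theorem ae_tendsto_setAverage_Ioo_right {g : ℝ → ℝ} (hab : a < b) (hg : IntegrableOn g (Ioo a b)) :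
    ∀ᵐ t, t ∈ Ioo a b → Tendsto (fun s => ⨍ x in Ioo t s, g x) (𝓝[>] t) (𝓝 (g t)) := by
  have hi : IntervalIntegrable g volume a b := by
    rwa [intervalIntegrable_iff_integrableOn_Ioo_of_le hab.le]
  filter_upwards [hi.ae_hasDerivAt_integral] with t hd ht
  rw [uIcc_of_le hab.le] at hd
  have hd := (hd ⟨ht.1.le, ht.2.le⟩ a ⟨le_rfl, hab.le⟩)
  have hlim := (hasDerivAt_iff_tendsto_slope.1 hd).mono_left
    (nhdsWithin_mono t (show Ioi t ⊆ {t}ᶜ from fun x hx => ne_of_gt hx))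
  refine hlim.congr' ?_
  filter_upwards [Ioc_mem_nhdsGT ht.2] with s hs
  rw [slope_def_field, setAverage_Ioo_eq_primitive hg ht.1.le hs.1 hs.2, div_eq_inv_mul]

/-- Averages over intervals exhausting a given interval. -/
theorem tendsto_setAverage_Ioo_shrink {c d : ℝ} {g : ℝ → ℝ} (hg : IntegrableOn g (Ioo a b))
    (hac : a ≤ c) (hcd : c < d) (hdb : d ≤ b) :
    Tendsto (fun δ => ⨍ t in Ioo (c + δ) (d - δ), g t) (𝓝[>] 0) (𝓝 (⨍ t in Ioo c d, g t)) := by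
  have hab : a ≤ b := hac.trans (hcd.le.trans hdb)
  have hi : IntervalIntegrable g volume a b := by
    rwa [intervalIntegrable_iff_integrableOn_Ioo_of_le hab]
  have hG : ContinuousOn (fun x => ∫ t in a..x, g t) (Icc a b) := by
    have := intervalIntegral.continuousOn_primitive_interval' hi left_mem_uIcc
    rwa [uIcc_of_le hab] at this
  have hsmall : ∀ᶠ δ : ℝ in 𝓝[>] 0, 0 < δ ∧ δ < (d - c) / 2 :=
    Ioo_mem_nhdsGT (by linarith)
  have h1 : Tendsto (fun δ : ℝ => c + δ) (𝓝[>] 0) (𝓝[Icc a b] c) := by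
    refine tendsto_nhdsWithin_iff.2 ⟨?_, hsmall.mono fun δ h => ⟨by linarith, by linarith⟩⟩
    refine tendsto_nhdsWithin_of_tendsto_nhds ?_
    exact (Continuous.tendsto' (by fun_prop) _ _ (by simp))
  have h2 : Tendsto (fun δ : ℝ => d - δ) (𝓝[>] 0) (𝓝[Icc a b] d) := by
    refine tendsto_nhdsWithin_iff.2 ⟨?_, hsmall.mono fun δ h => ⟨by linarith, by linarith⟩⟩
    refine tendsto_nhdsWithin_of_tendsto_nhds ?_
    exact (Continuous.tendsto' (by fun_prop) _ _ (by simp))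
  have h3 := (hG c ⟨hac, hcd.le.trans hdb⟩).tendsto.comp h1
  have h4 := (hG d ⟨hac.trans hcd.le, hdb⟩).tendsto.comp h2
  have h5 : Tendsto (fun δ : ℝ => ((d - δ) - (c + δ))⁻¹) (𝓝[>] 0) (𝓝 (d - c)⁻¹) := by
    refine tendsto_nhdsWithin_of_tendsto_nhds (Tendsto.inv₀ ?_ (by linarith))
    exact (Continuous.tendsto' (by fun_prop) _ _ (by simp))
  rw [setAverage_Ioo_eq_primitive hg hac hcd hdb]
  refine (h5.mul (h4.sub h3)).congr' ?_
  filter_upwards [hsmall] with δ h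
  rw [setAverage_Ioo_eq_primitive hg (by linarith) (by linarith) (by linarith)]
  rfl

end Cond

/-! ### Averages of a function against averages of its monotone rearrangement. -/

variable {a b c d : ℝ} {f fs : ℝ → ℝ}

/-- Monotonicity upgrades "almost everywhere" to "everywhere": each value lies between values taken
at good points on either side. -/
theorem mem_of_monotoneOn_or_antitoneOn (hmono : MonotoneOn fs (Ioo c d) ∨ AntitoneOn fs (Ioo c d))
    {D : Set ℝ} (hD : D.OrdConnected) (hfD : ∀ᵐ t ∂volume.restrict (Ioo c d), fs t ∈ D) {t : ℝ}
    (ht : t ∈ Ioo c d) : fs t ∈ D := by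
  rw [ae_restrict_iff' measurableSet_Ioo] at hfD
  have hex : ∀ x y : ℝ, x < y → c ≤ x → y ≤ d → ∃ s ∈ Ioo x y, fs s ∈ D := by
    intro x y hxy hx hy
    by_contra! hcon
    have : volume (Ioo x y) = 0 := by
      refine measure_mono_null (fun s hs => ?_) (ae_iff.1 hfD)
      exact fun h => hcon s hs (h ⟨hx.trans_lt hs.1, hs.2.trans_le hy⟩)
    simp at this
    linarith
  obtain ⟨s₁, h1, h1D⟩ := hex c t ht.1 le_rfl ht.2.le
  obtain ⟨s₂, h2, h2D⟩ := hex t d ht.2 ht.1.le le_rfl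
  have hs1 : s₁ ∈ Ioo c d := ⟨h1.1, h1.2.trans ht.2⟩
  have hs2 : s₂ ∈ Ioo c d := ⟨ht.1.trans h2.1, h2.2⟩
  rcases hmono with h | h
  · exact hD.out h1D h2D ⟨h hs1 ht h1.2.le, h ht hs2 h2.1.le⟩
  · exact hD.out h2D h1D ⟨h ht hs2 h2.1.le, h hs1 ht h1.2.le⟩

/-- The values at `α` and `β` serve as `p` and `q`. This needs both points inside the open interval,
as a monotone function may blow up at its ends. -/
theorem exists_endpoints_of_monotoneOn_or_antitoneOn
    (hmono : MonotoneOn fs (Ioo c d) ∨ AntitoneOn fs (Ioo c d))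
    {α β : ℝ} (hα : c < α) (hαβ : α < β) (hβ : β < d) :
    ∃ p q, p ∈ fs '' Ioo c d ∧ q ∈ fs '' Ioo c d ∧
      ∀ t ∈ Ioo c d, (t ∈ Ioo α β → fs t ∈ Icc p q) ∧ (t ∉ Ioo α β → fs t ∉ Ioo p q) := by
  have h1 : α ∈ Ioo c d := ⟨hα, hαβ.trans hβ⟩
  have h2 : β ∈ Ioo c d := ⟨hα.trans hαβ, hβ⟩
  rcases hmono with h | h
  · refine ⟨fs α, fs β, mem_image_of_mem _ h1, mem_image_of_mem _ h2, fun t ht =>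
      ⟨fun htJ => ⟨h h1 ht htJ.1.le, h ht h2 htJ.2.le⟩, fun htJ htI => htJ ⟨?_, ?_⟩⟩⟩
    · by_contra! h'; exact (h ht h1 h').not_gt htI.1
    · by_contra! h'; exact (h h2 ht h').not_gt htI.2
  · refine ⟨fs β, fs α, mem_image_of_mem _ h2, mem_image_of_mem _ h1, fun t ht =>
      ⟨fun htJ => ⟨h ht h2 htJ.2.le, h h1 ht htJ.1.le⟩, fun htJ htI => htJ ⟨?_, ?_⟩⟩⟩
    · by_contra! h'; exact (h ht h1 h').not_gt htI.2
    · by_contra! h'; exact (h h2 ht h').not_gt htI.1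

/-- The degenerate case, where no `p < m < q` exist. Then `f` equals `m` on a set of positive
measure, and short intervals starting at a Lebesgue point of `f` and `h ∘ f` in that set have
averages close to `(m, h m)`. -/
theorem exists_interval_average_mem_of_ae_eq_const (hab : a < b)
    (hid : IdentDistrib fs f (cond volume (Ioo c d)) (cond volume (Ioo a b))) {h : ℝ → ℝ}
    (hf : IntegrableOn f (Ioo a b)) (hhf : IntegrableOn (fun t => h (f t)) (Ioo a b))
    {U : Set (ℝ × ℝ)} (hU : IsOpen U) {α β m : ℝ} (hα : c ≤ α) (hαβ : α < β) (hβ : β ≤ d)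
    (hm : ∀ᵐ t ∂volume.restrict (Ioo α β), fs t = m) (hmem : (m, h m) ∈ U) :
    ∃ k l, a ≤ k ∧ k < l ∧ l ≤ b ∧ (⨍ t in Ioo k l, f t, ⨍ t in Ioo k l, h (f t)) ∈ U := by
  have hex : ¬ ∀ᵐ t ∂volume.restrict (Ioo a b), f t ≠ m := by
    intro hcon
    rw [← ae_cond_Ioo_iff] at hcon
    have h1 : ∀ᵐ t ∂cond volume (Ioo c d), fs t ≠ m :=
      hid.symm.ae_snd (p := fun x => x ≠ m) (measurableSet_singleton m).compl hcon
    rw [ae_cond_Ioo_iff] at h1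
    have h2 := ae_restrict_of_ae_restrict_of_subset (Ioo_subset_Ioo hα hβ) h1
    have h3 : ∀ᵐ t ∂volume.restrict (Ioo α β), False := by
      filter_upwards [hm, h2] with t h h' using h' h
    simp only [eventually_false_iff_eq_bot, ae_eq_bot, Measure.restrict_eq_zero,
      Real.volume_Ioo, ENNReal.ofReal_eq_zero] at h3
    linarith
  rw [ae_restrict_iff' measurableSet_Ioo] at hex
  obtain ⟨t, ht, htab, htm⟩ : ∃ t, ((t ∈ Ioo a b →
      Tendsto (fun s => ⨍ x in Ioo t s, f x) (𝓝[>] t) (𝓝 (f t))) ∧ (t ∈ Ioo a b →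
      Tendsto (fun s => ⨍ x in Ioo t s, h (f x)) (𝓝[>] t) (𝓝 (h (f t))))) ∧
      t ∈ Ioo a b ∧ f t = m := by
    by_contra! hcon
    apply hex
    filter_upwards [ae_tendsto_setAverage_Ioo_right hab hf,
      ae_tendsto_setAverage_Ioo_right hab hhf] with t h1 h2 h3 using hcon t ⟨h1, h2⟩ h3
  have hlim := (ht.1 htab).prodMk_nhds (ht.2 htab)
  rw [htm] at hlim
  obtain ⟨s, hsU, hs⟩ := ((hlim.eventually (hU.mem_nhds hmem)).and
    (Ioc_mem_nhdsGT htab.2)).exists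
  exact ⟨t, s, htab.1.le, hs.1, hs.2, hsU⟩

theorem exists_interval_average_mem_aux (hab : a < b) (hcd : c < d)
    (hid : IdentDistrib fs f (cond volume (Ioo c d)) (cond volume (Ioo a b)))
    (hmono : MonotoneOn fs (Ioo c d) ∨ AntitoneOn fs (Ioo c d)) {D : Set ℝ} {h : ℝ → ℝ}
    (hh : ConvexOn ℝ D h) (hmeas : Measurable h)
    (hfD : ∀ᵐ t ∂volume.restrict (Ioo c d), fs t ∈ D) (hf : IntegrableOn f (Ioo a b))
    (hhf : IntegrableOn (fun t => h (f t)) (Ioo a b)) {U : Set (ℝ × ℝ)} (hU : IsOpen U)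
    (hup : ∀ x y y', (x, y) ∈ U → y ≤ y' → (x, y') ∈ U) {α β : ℝ} (hα : c < α) (hαβ : α < β)
    (hβ : β < d) (hmem : (⨍ t in Ioo α β, fs t, ⨍ t in Ioo α β, h (fs t)) ∈ U) :
    ∃ k l, a ≤ k ∧ k < l ∧ l ≤ b ∧ (⨍ t in Ioo k l, f t, ⨍ t in Ioo k l, h (f t)) ∈ U := by
  have := isProbabilityMeasure_cond_Ioo hab
  have := isProbabilityMeasure_cond_Ioo hcd
  set P := cond volume (Ioo a b) with hP
  set Q := cond volume (Ioo c d) with hQ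
  set m := ⨍ t in Ioo α β, fs t with hm
  set y := ⨍ t in Ioo α β, h (fs t) with hy
  have hJsub : Ioo α β ⊆ Ioo c d := Ioo_subset_Ioo hα.le hβ.le
  have hfP : Integrable f P := (integrable_cond_Ioo_iff hab).2 hf
  have hhfP : Integrable (fun t => h (f t)) P := (integrable_cond_Ioo_iff hab).2 hhf
  have hfsQ : Integrable fs Q := hid.integrable_iff.2 hfP
  have hfs : IntegrableOn fs (Ioo c d) := (integrable_cond_Ioo_iff hcd).1 hfsQ
  have hfsJ : IntegrableOn (fun t => fs t - m) (Ioo α β) :=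
    (hfs.mono_set hJsub).sub (integrable_const m)
  have hlen : 0 < β - α := by linarith
  have hJm : ∫ t in Ioo α β, (fs t - m) = 0 := by
    rw [integral_sub (hfs.mono_set hJsub) (integrable_const m), hm, setAverage_Ioo_eq hαβ]
    simp [hαβ.le, hlen.ne']
  obtain ⟨p, q, ⟨tp, htp, rfl⟩, ⟨tq, htq, rfl⟩, hpq⟩ :=
    exists_endpoints_of_monotoneOn_or_antitoneOn hmono hα hαβ hβ
  have hpD := mem_of_monotoneOn_or_antitoneOn hmono hh.1.ordConnected hfD htp
  have hqD := mem_of_monotoneOn_or_antitoneOn hmono hh.1.ordConnected hfD htq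
  set p := fs tp
  set q := fs tq
  by_cases hconst : ∀ᵐ t ∂volume.restrict (Ioo α β), fs t = m
  · refine exists_interval_average_mem_of_ae_eq_const hab hid hf hhf hU hα.le hαβ hβ.le hconst ?_
    have : y = h m := by
      rw [hy, setAverage_Ioo_eq hαβ, integral_congr_ae (hconst.mono fun t ht => congrArg h ht)]
      simp [hαβ.le, hlen.ne']
    rwa [this] at hmem
  have hpm : p < m := by
    by_contra! hcon
    apply hconst
    have hnn : 0 ≤ᵐ[volume.restrict (Ioo α β)] fun t => fs t - m := by
      refine (ae_restrict_iff' measurableSet_Ioo).2 (ae_of_all _ fun t ht => ?_)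
      exact sub_nonneg.2 (hcon.trans ((hpq t (hJsub ht)).1 ht).1)
    filter_upwards [(integral_eq_zero_iff_of_nonneg_ae hnn hfsJ).1 hJm] with t ht
    exact sub_eq_zero.1 ht
  have hmq : m < q := by
    by_contra! hcon
    apply hconst
    have hnn : 0 ≤ᵐ[volume.restrict (Ioo α β)] fun t => -(fs t - m) := by
      refine (ae_restrict_iff' measurableSet_Ioo).2 (ae_of_all _ fun t ht => ?_)
      exact neg_nonneg.2 (sub_nonpos.2 (((hpq t (hJsub ht)).1 ht).2.trans hcon))
    filter_upwards [(integral_eq_zero_iff_of_nonneg_ae hnn hfsJ.neg).1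
      (by rw [integral_neg, hJm, neg_zero])] with t ht
    exact sub_eq_zero.1 (neg_eq_zero.1 ht)
  -- Every component of `E` reproduces the first coordinate `m` exactly, so only the second
  -- coordinate has to be compared.
  obtain ⟨E, hEab, hEo, hoff, hgap⟩ := exists_isOpen_rising_sun (F := fun t => f t - m) hab
    (hf.sub (integrable_const m))
  have hEm : ∫ t in E, (f t - m) = 0 := by
    refine (hasSum_setIntegral_gapEndpoints hEo hEab (hf.sub (integrable_const m))).unique ?_
    convert hasSum_zero with z
    exact hgap z.1 z.2
  have hEP := setIntegral_cond_Ioo hab hEo.measurableSet hEab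
  have hJQ := setIntegral_cond_Ioo hcd measurableSet_Ioo hJsub
  have hEm' : ∫ t in E, (f t - m) ∂P = 0 := by rw [hEP, hEm, mul_zero]
  have hJm' : ∫ t in Ioo α β, (fs t - m) ∂Q = 0 := by rw [hJQ, hJm, mul_zero]
  have hpos := setIntegral_posPart_le hid hfP hEo.measurableSet hEm' hJm' (by
    simp only [hP, ae_cond_Ioo_iff, ae_restrict_iff' measurableSet_Ioo]
    exact hoff.imp (fun h => h.mono fun t h h1 h2 => sub_nonpos.1 (h h1 h2))
      (fun h => h.mono fun t h h1 h2 => sub_nonneg.1 (h h1 h2)))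
  have hJreal : Q.real (Ioo α β) = (d - c)⁻¹ * (β - α) := by
    rw [measureReal_cond_Ioo hcd measurableSet_Ioo hJsub, Real.volume_real_Ioo_of_le hαβ.le]
  have hJ0 : 0 < Q.real (Ioo α β) := by
    rw [hJreal]
    have : 0 < d - c := by linarith
    positivity
  have hcore := mul_le_setIntegral_convex_comp (y := y) hid hh hmeas (ae_cond_Ioo_iff.2 hfD)
    hfP hhfP hEo.measurableSet (measurableSet_Ioo (a := α) (b := β)) hpD hqD hpm hmq
    (ae_cond_Ioo_iff.2 ((ae_restrict_iff' measurableSet_Ioo).2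
      (ae_of_all _ fun t ht => (hpq t ht).1)))
    (ae_cond_Ioo_iff.2 ((ae_restrict_iff' measurableSet_Ioo).2
      (ae_of_all _ fun t ht => (hpq t ht).2))) hEm' hJm' hpos hJ0
    (by
      rw [hJQ, hJreal, hy, setAverage_Ioo_eq hαβ]
      field_simp)
  -- If `E` were empty, `hpos` would kill the positive part of `fs - m` on `J`; having mean zero,
  -- `fs - m` would vanish there, against `hconst`.
  have hE0 : E.Nonempty := by
    by_contra! hE
    rw [hE, setIntegral_empty, hJQ] at hpos
    have h0 : 0 < d - c := sub_pos.2 hcd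
    have h1 : ∫ t in Ioo α β, max (fs t - m) 0 ≤ 0 := by
      by_contra! h
      have : 0 < (d - c)⁻¹ * ∫ t in Ioo α β, max (fs t - m) 0 := by positivity
      linarith
    have hmax : IntegrableOn (fun t => max (fs t - m) 0) (Ioo α β) :=
      hfsJ.sup (integrable_zero _ _ _)
    have h2 := (integral_eq_zero_iff_of_nonneg (fun t => le_max_right _ _) hmax).1
      (le_antisymm h1 (integral_nonneg fun t => le_max_right _ _))
    have hnn : 0 ≤ᵐ[volume.restrict (Ioo α β)] fun t => -(fs t - m) := by
      filter_upwards [h2] with t ht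
      exact neg_nonneg.2 (max_eq_right_iff.1 ht)
    apply hconst
    filter_upwards [(integral_eq_zero_iff_of_nonneg_ae hnn hfsJ.neg).1
      (by rw [integral_neg, hJm, neg_zero])] with t ht
    exact sub_eq_zero.1 (neg_eq_zero.1 ht)
  obtain ⟨z, hz, hz0⟩ := exists_gapEndpoints_setIntegral_nonneg hEo hEab hE0
    (g := fun t => h (f t) - y) (hhf.sub (integrable_const y)) (by
      rw [integral_sub (hhf.mono_set hEab) (integrableOn_const (by
        exact ((measure_mono hEab).trans_lt (by simp)).ne))]
      rw [hEP, measureReal_cond_Ioo hab hEo.measurableSet hEab, mul_assoc] at hcore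
      have h1 : 0 < (b - a)⁻¹ := inv_pos.2 (by linarith)
      have h2 := le_of_mul_le_mul_left hcore h1
      simpa using h2)
  obtain ⟨hz1, hz2⟩ := mem_Icc_of_gapEndpoints hEab hz
  refine ⟨z.1, z.2, hz1, hz.1, hz2, hup _ y _ ?_ ?_⟩
  · have h0 : 0 < z.2 - z.1 := sub_pos.2 hz.1
    have h1 := hgap z hz
    rw [integral_sub (hf.mono_set (Ioo_subset_Ioo hz1 hz2)) (integrable_const m)] at h1
    have h2 : ⨍ t in Ioo z.1 z.2, f t = m := by
      rw [setAverage_Ioo_eq hz.1, sub_eq_zero.1 h1]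
      simp [hz.1.le, h0.ne']
    rwa [h2]
  · have h0 : 0 < z.2 - z.1 := sub_pos.2 hz.1
    rw [integral_sub (hhf.mono_set (Ioo_subset_Ioo hz1 hz2)) (integrable_const y)] at hz0
    rw [setAverage_Ioo_eq hz.1, ← div_eq_inv_mul, le_div_iff₀ h0]
    simp [hz.1.le] at hz0
    linarith

/-- **Comparison of averages.** Let `fs` be a monotone rearrangement of `f` and let `h` be convex.
If the averages of `fs` and `h ∘ fs` over some interval form a point of an open set `U` which is
closed upwards in the second coordinate, then so do the averages of `f` and `h ∘ f` over some
interval. -/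
theorem exists_interval_average_mem (hab : a < b) (hcd : c < d)
    (hid : IdentDistrib fs f (cond volume (Ioo c d)) (cond volume (Ioo a b)))
    (hmono : MonotoneOn fs (Ioo c d) ∨ AntitoneOn fs (Ioo c d)) {D : Set ℝ} {h : ℝ → ℝ}
    (hh : ConvexOn ℝ D h) (hmeas : Measurable h)
    (hfD : ∀ᵐ t ∂volume.restrict (Ioo c d), fs t ∈ D) (hf : IntegrableOn f (Ioo a b))
    (hhf : IntegrableOn (fun t => h (f t)) (Ioo a b)) {U : Set (ℝ × ℝ)} (hU : IsOpen U)
    (hup : ∀ x y y', (x, y) ∈ U → y ≤ y' → (x, y') ∈ U) {α β : ℝ} (hα : c ≤ α) (hαβ : α < β)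
    (hβ : β ≤ d) (hmem : (⨍ t in Ioo α β, fs t, ⨍ t in Ioo α β, h (fs t)) ∈ U) :
    ∃ k l, a ≤ k ∧ k < l ∧ l ≤ b ∧ (⨍ t in Ioo k l, f t, ⨍ t in Ioo k l, h (f t)) ∈ U := by
  have hfs : IntegrableOn fs (Ioo c d) := (integrable_cond_Ioo_iff hcd).1
    (hid.integrable_iff.2 ((integrable_cond_Ioo_iff hab).2 hf))
  have hhfs : IntegrableOn (fun t => h (fs t)) (Ioo c d) := (integrable_cond_Ioo_iff hcd).1
    ((hid.comp hmeas).integrable_iff.2 ((integrable_cond_Ioo_iff hab).2 hhf))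
  -- Since `U` is open, an interval touching the ends can be shrunk into the interior without
  -- leaving `U`.
  have hlim := (tendsto_setAverage_Ioo_shrink hfs hα hαβ hβ).prodMk_nhds
    (tendsto_setAverage_Ioo_shrink hhfs hα hαβ hβ)
  obtain ⟨δ, hδU, hδ⟩ := ((hlim.eventually (hU.mem_nhds hmem)).and
    (Ioo_mem_nhdsGT (show (0 : ℝ) < (β - α) / 2 by linarith))).exists
  have h1 := hδ.1
  have h2 := hδ.2
  exact exists_interval_average_mem_aux hab hcd hid hmono hh hmeas hfD hf hhf hU hup
    (by linarith) (by linarith) (by linarith) hδU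

end

/-! ### Existence of monotone rearrangements. -/

section

/-- The lower quantile function of a measure on the line. -/
def quantile (μ : Measure ℝ) (s : ℝ) : ℝ := sInf {x | s ≤ cdf μ x}

/-- Right continuity of the distribution function makes the infimum attained. This Galois connection
gives both monotonicity and the distribution of the quantile function. -/
theorem quantile_le_iff (μ : Measure ℝ) {s : ℝ} (hs : s ∈ Ioo (0 : ℝ) 1)
    (x : ℝ) : quantile μ s ≤ x ↔ s ≤ cdf μ x := by
  have hne : {x | s ≤ cdf μ x}.Nonempty :=
    ((tendsto_cdf_atTop μ).eventually (lt_mem_nhds hs.2)).exists.imp fun _ h => h.le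
  have hbdd : BddBelow {x | s ≤ cdf μ x} := by
    obtain ⟨z, hz⟩ := ((tendsto_cdf_atBot μ).eventually (gt_mem_nhds hs.1)).exists
    refine ⟨z, fun y hy => ?_⟩
    by_contra! h
    exact ((monotone_cdf μ h.le).trans_lt hz).not_ge hy
  constructor
  · intro h
    have hright : ∀ y, quantile μ s < y → s ≤ cdf μ y := by
      intro y hy
      obtain ⟨z, hz, hzy⟩ := exists_lt_of_csInf_lt hne hy
      exact le_trans hz (monotone_cdf μ hzy.le)
    have hlim : Tendsto (cdf μ) (𝓝[>] x) (𝓝 (cdf μ x)) :=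
      ((cdf μ).right_continuous x).tendsto.mono_left (nhdsWithin_mono _ Ioi_subset_Ici_self)
    exact ge_of_tendsto hlim (eventually_mem_nhdsWithin.mono fun y hy => hright y (h.trans_lt hy))
  · exact fun h => csInf_le hbdd h

/-- Every real random variable has a non-decreasing rearrangement. -/
theorem exists_monotoneOn_identDistrib {X : Type*} [MeasurableSpace X] {P : Measure X}
    [IsProbabilityMeasure P] {f : X → ℝ} (hf : AEMeasurable f P) {c d : ℝ} (hcd : c < d) :
    ∃ g : ℝ → ℝ, MonotoneOn g (Ioo c d) ∧ IdentDistrib g f (cond volume (Ioo c d)) P := by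
  have := isProbabilityMeasure_cond_Ioo hcd
  have : IsProbabilityMeasure (P.map f) := Measure.isProbabilityMeasure_map hf
  have hlen : 0 < d - c := sub_pos.2 hcd
  set μ := P.map f
  have hunit : ∀ t ∈ Ioo c d, (t - c) / (d - c) ∈ Ioo (0 : ℝ) 1 := fun t ht =>
    ⟨div_pos (sub_pos.2 ht.1) hlen, (div_lt_one hlen).2 (by linarith [ht.2])⟩
  set g : ℝ → ℝ := fun t => quantile μ ((t - c) / (d - c)) with hg
  have hmono : MonotoneOn g (Ioo c d) := by
    intro s hs t ht hst
    rw [hg, quantile_le_iff μ (hunit s hs)]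
    refine le_trans ?_ ((quantile_le_iff μ (hunit t ht) _).1 le_rfl)
    gcongr
  have hgm : AEMeasurable g (cond volume (Ioo c d)) :=
    aemeasurable_cond_Ioo_iff.2 (aemeasurable_restrict_of_monotoneOn measurableSet_Ioo hmono)
  refine ⟨g, hmono, hgm, hf, ?_⟩
  have : IsProbabilityMeasure ((cond volume (Ioo c d)).map g) :=
    Measure.isProbabilityMeasure_map hgm
  refine Measure.ext_of_Iic _ _ fun x => ?_
  rw [← ENNReal.toReal_eq_toReal_iff' (measure_ne_top _ _) (measure_ne_top _ _),
    Measure.map_apply_of_aemeasurable hgm measurableSet_Iic]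
  change _ = μ.real (Iic x)
  rw [← cdf_eq_real]
  have h0 := cdf_nonneg μ x
  have h1 := cdf_le_one μ x
  set F := cdf μ x with hF
  -- By the Galois connection the sublevel set is an initial piece of the interval, of relative
  -- length `F`.
  have hset : Ioo c d ∩ g ⁻¹' Iic x = Ioo c d ∩ Iic (c + (d - c) * F) := by
    ext t
    refine and_congr_right fun ht => ?_
    rw [mem_preimage, mem_Iic, hg, quantile_le_iff μ (hunit t ht), ← hF, mem_Iic,
      div_le_iff₀ hlen]
    constructor <;> intro h <;> linarith
  rw [cond_apply measurableSet_Ioo, hset]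
  have hvol : volume (Ioo c d ∩ Iic (c + (d - c) * F)) = ENNReal.ofReal ((d - c) * F) := by
    apply le_antisymm
    · calc volume (Ioo c d ∩ Iic (c + (d - c) * F)) ≤ volume (Ioc c (c + (d - c) * F)) :=
            measure_mono fun t ht => ⟨ht.1.1, ht.2⟩
        _ = _ := by rw [Real.volume_Ioc]; congr 1; ring
    · calc ENNReal.ofReal ((d - c) * F) = volume (Ioo c (c + (d - c) * F)) := by
            rw [Real.volume_Ioo]; congr 1; ring
        _ ≤ _ := by
          refine measure_mono fun t ht => ?_
          exact ⟨⟨ht.1, ht.2.trans_le (by nlinarith)⟩, ht.2.le⟩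
  rw [hvol, Real.volume_Ioo, ENNReal.toReal_mul, ENNReal.toReal_inv,
    ENNReal.toReal_ofReal hlen.le, ENNReal.toReal_ofReal (by positivity)]
  field_simp

variable {a b c d : ℝ}

theorem exists_isNondecreasingRearrangement (hab : a < b) (hcd : c < d) {ψ : ℝ → ℝ}
    (hψ : AEMeasurable ψ (volume.restrict (Ioo a b))) :
    ∃ ψs, IsNondecreasingRearrangement a b ψ c d ψs := by
  have := isProbabilityMeasure_cond_Ioo hab
  obtain ⟨g, h1, h2⟩ := exists_monotoneOn_identDistrib (aemeasurable_cond_Ioo_iff.2 hψ) hcd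
  exact ⟨g, mapsTo_univ _ _, h1, h2⟩

theorem exists_isNonincreasingRearrangement (hab : a < b) (hcd : c < d) {ψ : ℝ → ℝ}
    (hψ : AEMeasurable ψ (volume.restrict (Ioo a b))) :
    ∃ ψs, IsNonincreasingRearrangement a b ψ c d ψs := by
  obtain ⟨g, h1, h2, h3⟩ := exists_isNondecreasingRearrangement hab hcd hψ.neg
  refine ⟨fun t => -g t, mapsTo_univ _ _, by simpa using h2, ?_⟩
  simpa [Function.comp_def] using h3.comp measurable_neg

theorem IsMonotoneRearrangement.monotoneOn_or_antitoneOn {ψ ψs : ℝ → ℝ}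
    (h : IsMonotoneRearrangement a b ψ c d ψs) :
    MonotoneOn ψs (Ioo c d) ∨ AntitoneOn ψs (Ioo c d) :=
  h.imp (fun h => h.monotoneOn) fun h _ hs _ ht hst => neg_le_neg_iff.1 (h.monotoneOn hs ht hst)

theorem IsMonotoneRearrangement.identDistrib {ψ ψs : ℝ → ℝ}
    (h : IsMonotoneRearrangement a b ψ c d ψs) :
    IdentDistrib ψs ψ (cond volume (Ioo c d)) (cond volume (Ioo a b)) :=
  h.elim IsRearrangement.identDistrib IsRearrangement.identDistrib

end

/-! ### BMO, Muckenhoupt and Gehring classes. -/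

section

variable {a b c d : ℝ} {w ws : ℝ → ℝ}

theorem IsMonotoneRearrangement.ae_mem (hR : IsMonotoneRearrangement a b w c d ws) {D : Set ℝ}
    (hD : MeasurableSet D) (hw : ∀ᵐ t ∂volume.restrict (Ioo a b), w t ∈ D) :
    ∀ᵐ t ∂volume.restrict (Ioo c d), ws t ∈ D :=
  ae_cond_Ioo_iff.1 (hR.identDistrib.symm.ae_mem_snd hD (ae_cond_Ioo_iff.2 hw))

theorem IsMonotoneRearrangement.integrableOn_comp (hab : a < b) (hcd : c < d)
    (hR : IsMonotoneRearrangement a b w c d ws) {h : ℝ → ℝ} (hh : Measurable h)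
    (hw : IntegrableOn (fun t => h (w t)) (Ioo a b)) :
    IntegrableOn (fun t => h (ws t)) (Ioo c d) :=
  (integrable_cond_Ioo_iff hcd).1
    ((hR.identDistrib.comp hh).integrable_iff.2 ((integrable_cond_Ioo_iff hab).2 hw))

/-- A bound for the averages of `w` and `h ∘ w` over all intervals is inherited by the monotone
rearrangements of `w`. -/
theorem IsMonotoneRearrangement.apply_average_le (hab : a < b) (hcd : c < d)
    (hR : IsMonotoneRearrangement a b w c d ws) {D : Set ℝ} {h : ℝ → ℝ} (hh : ConvexOn ℝ D h)
    (hmeas : Measurable h) (hD : MeasurableSet D)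
    (hwD : ∀ᵐ t ∂volume.restrict (Ioo a b), w t ∈ D) (hw : IntegrableOn w (Ioo a b))
    (hhw : IntegrableOn (fun t => h (w t)) (Ioo a b)) {W : Set (ℝ × ℝ)} (hW : IsOpen W)
    (hup : ∀ x y y', (x, y) ∈ W → y ≤ y' → (x, y') ∈ W) {Φ : ℝ × ℝ → ℝ} (hΦ : ContinuousOn Φ W)
    (hΦmono : ∀ x y y', (x, y) ∈ W → y ≤ y' → Φ (x, y) ≤ Φ (x, y')) {C : ℝ}
    (hC : ∀ k l, a ≤ k → k < l → l ≤ b → Φ (⨍ t in Ioo k l, w t, ⨍ t in Ioo k l, h (w t)) ≤ C)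
    {α β : ℝ} (hα : c ≤ α) (hαβ : α < β) (hβ : β ≤ d)
    (hmem : (⨍ t in Ioo α β, ws t, ⨍ t in Ioo α β, h (ws t)) ∈ W) :
    Φ (⨍ t in Ioo α β, ws t, ⨍ t in Ioo α β, h (ws t)) ≤ C := by
  by_contra! hlt
  -- The forbidden set is the superlevel set of `Φ` in `W`: continuity makes it open, monotonicity
  -- in the second variable makes it upward closed.
  obtain ⟨k, l, h1, h2, h3, h4⟩ := exists_interval_average_mem hab hcd hR.identDistrib
    hR.monotoneOn_or_antitoneOn hh hmeas (hR.ae_mem hD hwD) hw hhw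
    (U := W ∩ Φ ⁻¹' Ioi C) (hΦ.isOpen_inter_preimage hW isOpen_Ioi)
    (fun x y y' hxy hy => ⟨hup x y y' hxy.1 hy, hxy.2.trans_le (hΦmono x y y' hxy.1 hy)⟩)
    hα hαβ hβ ⟨hmem, hlt⟩
  exact (hC k l h1 h2 h3).not_gt h4.2

theorem setAverage_sub_setAverage_sq {ψ : ℝ → ℝ} {k l : ℝ} (hkl : k < l)
    (h1 : IntegrableOn ψ (Ioo k l)) (h2 : IntegrableOn (fun t => ψ t ^ 2) (Ioo k l)) :
    ⨍ t in Ioo k l, (ψ t - ⨍ s in Ioo k l, ψ s) ^ 2 =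
      (⨍ t in Ioo k l, ψ t ^ 2) - (⨍ t in Ioo k l, ψ t) ^ 2 := by
  set m := ⨍ s in Ioo k l, ψ s with hm
  have hlen : 0 < l - k := sub_pos.2 hkl
  have h3 : IntegrableOn (fun t => 2 * m * ψ t) (Ioo k l) := h1.const_mul _
  have h4 : IntegrableOn (fun _ => m ^ 2) (Ioo k l) := integrable_const _
  have h5 : ∫ t in Ioo k l, ψ t = (l - k) * m := by
    rw [hm, setAverage_Ioo_eq hkl]; field_simp
  have h6 : ∫ t in Ioo k l, (ψ t - m) ^ 2 =
      (∫ t in Ioo k l, ψ t ^ 2) - 2 * m * ((l - k) * m) + (l - k) * m ^ 2 := by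
    calc ∫ t in Ioo k l, (ψ t - m) ^ 2 = ∫ t in Ioo k l, (ψ t ^ 2 - 2 * m * ψ t + m ^ 2) := by
          congr 1 with t; ring
      _ = _ := by
          rw [integral_add (by exact h2.sub h3) h4, integral_sub h2 h3, integral_const_mul, h5]
          simp [hkl.le]
  rw [setAverage_Ioo_eq hkl, setAverage_Ioo_eq hkl, h6]
  field_simp
  ring

theorem IsMonotoneRearrangement.mem_bmoBall (hab : a < b) (hcd : c < d) {ε : ℝ}
    (hR : IsMonotoneRearrangement a b w c d ws) (hw : w ∈ bmoBall ε a b) :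
    ws ∈ bmoBall ε c d := by
  obtain ⟨h1, h2, h3⟩ := hw
  have hsq : Measurable fun x : ℝ => x ^ 2 := by fun_prop
  have h1' : IntegrableOn ws (Ioo c d) := hR.integrableOn_comp hab hcd measurable_id h1
  have h2' := hR.integrableOn_comp hab hcd hsq h2
  refine ⟨h1', h2', fun α β hα hαβ hβ => ?_⟩
  rw [setAverage_sub_setAverage_sq hαβ (h1'.mono_set (Ioo_subset_Ioo hα hβ))
    (h2'.mono_set (Ioo_subset_Ioo hα hβ))]
  refine hR.apply_average_le hab hcd (D := univ) (h := fun x => x ^ 2) (even_two.convexOn_pow) hsq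
    -- The variance is the second moment minus the squared mean, whence this choice of `Φ`.
    MeasurableSet.univ (by simp) h1 h2 (W := univ) isOpen_univ (by simp)
    (Φ := fun z => z.2 - z.1 ^ 2) (by fun_prop) (fun x y y' _ h => by simpa using h)
    (fun k l hk hkl hl => ?_) hα hαβ hβ (mem_univ _)
  have := h3 k l hk hkl hl
  rwa [setAverage_sub_setAverage_sq hkl (h1.mono_set (Ioo_subset_Ioo hk hl))
    (h2.mono_set (Ioo_subset_Ioo hk hl))] at this

section Weights

/-- The power is the exponential of the convex function `q * log x`. -/
theorem convexOn_rpow_of_nonpos {q : ℝ} (hq : q ≤ 0) : ConvexOn ℝ (Ioi 0) fun x : ℝ => x ^ q := by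
  refine ⟨convex_Ioi 0, fun x hx y hy s t hs ht hst => ?_⟩
  have hxy := convex_Ioi (0 : ℝ) hx hy hs ht hst
  have hlog := strictConcaveOn_log_Ioi.concaveOn.2 hx hy hs ht hst
  have hexp := convexOn_exp.2 (mem_univ (Real.log x * q)) (mem_univ (Real.log y * q)) hs ht hst
  simp only [smul_eq_mul] at hxy hlog hexp ⊢
  rw [Real.rpow_def_of_pos hx, Real.rpow_def_of_pos hy, Real.rpow_def_of_pos hxy]
  refine le_trans (Real.exp_le_exp.2 ?_) hexp
  nlinarith [mul_le_mul_of_nonpos_right hlog hq]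

theorem laverage_Ioo_ne_zero {k l : ℝ} (hkl : k < l) {g : ℝ → ℝ}
    (hg : AEMeasurable g (volume.restrict (Ioo k l)))
    (hpos : ∀ᵐ t ∂volume.restrict (Ioo k l), 0 < g t) :
    ⨍⁻ t in Ioo k l, ENNReal.ofReal (g t) ∂volume ≠ 0 := by
  rw [setLAverage_eq, ENNReal.div_ne_zero]
  refine ⟨fun h => ?_, by simp⟩
  rw [lintegral_eq_zero_iff' hg.ennreal_ofReal] at h
  have h3 : ∀ᵐ t ∂volume.restrict (Ioo k l), False := by
    filter_upwards [hpos, h] with t h1 h2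
    simp at h2
    linarith
  simp only [eventually_false_iff_eq_bot, ae_eq_bot, Measure.restrict_eq_zero,
    Real.volume_Ioo, ENNReal.ofReal_eq_zero] at h3
  linarith

theorem laverage_Ioo_eq_top {k l : ℝ} {g : ℝ → ℝ}
    (hg : AEMeasurable g (volume.restrict (Ioo k l)))
    (hpos : ∀ᵐ t ∂volume.restrict (Ioo k l), 0 < g t) (hint : ¬ IntegrableOn g (Ioo k l)) :
    ⨍⁻ t in Ioo k l, ENNReal.ofReal (g t) ∂volume = ∞ := by
  rw [setLAverage_eq, ENNReal.div_eq_top]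
  refine Or.inr ⟨?_, by simp⟩
  by_contra h
  refine hint ⟨hg.aestronglyMeasurable, ?_⟩
  rw [hasFiniteIntegral_iff_ofReal (hpos.mono fun _ h => h.le)]
  exact lt_top_iff_ne_top.2 h

theorem laverage_Ioo_eq_ofReal {k l : ℝ} {g : ℝ → ℝ}
    (hpos : ∀ᵐ t ∂volume.restrict (Ioo k l), 0 < g t) (hint : IntegrableOn g (Ioo k l)) :
    ⨍⁻ t in Ioo k l, ENNReal.ofReal (g t) ∂volume = ENNReal.ofReal (⨍ t in Ioo k l, g t) :=
  by
  rw [laverage_eq]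
  exact (ofReal_average hint (hpos.mono fun _ h => h.le)).symm

theorem setAverage_Ioo_pos {k l : ℝ} (hkl : k < l) {g : ℝ → ℝ}
    (hpos : ∀ᵐ t ∂volume.restrict (Ioo k l), 0 < g t) (hint : IntegrableOn g (Ioo k l)) :
    0 < ⨍ t in Ioo k l, g t := by
  have h1 := laverage_Ioo_ne_zero hkl hint.aemeasurable hpos
  rw [laverage_Ioo_eq_ofReal hpos hint] at h1
  by_contra! h
  exact h1 (ENNReal.ofReal_eq_zero.2 h)

theorem ae_restrict_Ioo_mono {p : ℝ → Prop} (h : ∀ᵐ t ∂volume.restrict (Ioo a b), p t) {k l : ℝ}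
    (hk : a ≤ k) (hl : l ≤ b) : ∀ᵐ t ∂volume.restrict (Ioo k l), p t :=
  ae_restrict_of_ae_restrict_of_subset (Ioo_subset_Ioo hk hl) h

theorem ofReal_rpow_mul_rpow {x y r s : ℝ} (hx : 0 < x) (hy : 0 < y) :
    ENNReal.ofReal x ^ r * ENNReal.ofReal y ^ s = ENNReal.ofReal (x ^ r * y ^ s) := by
  rw [ENNReal.ofReal_rpow_of_pos hx, ENNReal.ofReal_rpow_of_pos hy, ← ENNReal.ofReal_mul (by positivity)]

/-- Comparison of `sup_J ⟨w⟩_J ^ r * ⟨w ^ p⟩_J ^ s` for a weight and for its rearrangement. -/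
theorem IsMonotoneRearrangement.average_rpow_le (hab : a < b) (hcd : c < d)
    (hR : IsMonotoneRearrangement a b w c d ws) (hw : IsWeight a b w) {p r s : ℝ}
    (hconv : ConvexOn ℝ (Ioi 0) fun x : ℝ => x ^ p) (hs : 0 ≤ s) (hint : IntegrableOn w (Ioo a b))
    (hintp : IntegrableOn (fun t => w t ^ p) (Ioo a b)) {C : ℝ≥0∞}
    (hC : ∀ k l, a ≤ k → k < l → l ≤ b → (⨍⁻ t in Ioo k l, ENNReal.ofReal (w t) ∂volume) ^ r *
      (⨍⁻ t in Ioo k l, ENNReal.ofReal (w t ^ p) ∂volume) ^ s ≤ C)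
    {α β : ℝ} (hα : c ≤ α) (hαβ : α < β) (hβ : β ≤ d) :
    (⨍⁻ t in Ioo α β, ENNReal.ofReal (ws t) ∂volume) ^ r *
      (⨍⁻ t in Ioo α β, ENNReal.ofReal (ws t ^ p) ∂volume) ^ s ≤ C := by
  by_cases hCtop : C = ∞
  · simp [hCtop]
  have hmeas : Measurable fun x : ℝ => x ^ p := by fun_prop
  have hpow : ∀ {x : ℝ}, 0 < x → 0 < x ^ p := fun h => Real.rpow_pos_of_pos h p
  have hpos' : ∀ᵐ t ∂volume.restrict (Ioo c d), 0 < ws t := hR.ae_mem measurableSet_Ioi hw.2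
  have hint' := hR.integrableOn_comp hab hcd measurable_id hint
  have hintp' := hR.integrableOn_comp hab hcd hmeas hintp
  have e1 : ∀ {u : ℝ → ℝ} {k l : ℝ}, k < l → (∀ᵐ t ∂volume.restrict (Ioo k l), 0 < u t) →
      IntegrableOn u (Ioo k l) → IntegrableOn (fun t => u t ^ p) (Ioo k l) →
      (⨍⁻ t in Ioo k l, ENNReal.ofReal (u t) ∂volume) ^ r *
        (⨍⁻ t in Ioo k l, ENNReal.ofReal (u t ^ p) ∂volume) ^ s =
      ENNReal.ofReal ((⨍ t in Ioo k l, u t) ^ r * (⨍ t in Ioo k l, u t ^ p) ^ s) := by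
    intro u k l hkl h1 h2 h3
    have h4 := h1.mono fun t h => hpow h
    rw [laverage_Ioo_eq_ofReal h1 h2, laverage_Ioo_eq_ofReal h4 h3,
      ofReal_rpow_mul_rpow (setAverage_Ioo_pos hkl h1 h2) (setAverage_Ioo_pos hkl h4 h3)]
  have hsub' := Ioo_subset_Ioo hα hβ
  have hp1 := ae_restrict_Ioo_mono hpos' hα hβ
  rw [e1 hαβ hp1 (hint'.mono_set hsub') (hintp'.mono_set hsub'),
    ENNReal.ofReal_le_iff_le_toReal hCtop]
  refine hR.apply_average_le hab hcd (h := fun x => x ^ p) hconv hmeas measurableSet_Ioi hw.2 hint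
    hintp (W := Ioi 0 ×ˢ Ioi 0) (isOpen_Ioi.prod isOpen_Ioi)
    (fun x y y' h hy => ⟨h.1, lt_of_lt_of_le h.2 hy⟩) (Φ := fun z => z.1 ^ r * z.2 ^ s) ?_ ?_
    (fun k l hk hkl hl => ?_) hα hαβ hβ ⟨?_, ?_⟩
  · exact (continuousOn_fst.rpow_const fun z hz => Or.inl (ne_of_gt hz.1)).mul
      (continuousOn_snd.rpow_const fun z hz => Or.inl (ne_of_gt hz.2))
  · rintro x y y' ⟨hx, hy⟩ hyy'
    have hx : 0 < x := hx
    have hy : 0 < y := hy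
    dsimp only
    gcongr
  · rw [← ENNReal.ofReal_le_iff_le_toReal hCtop]
    have hsub := Ioo_subset_Ioo hk hl
    refine le_trans (e1 hkl (ae_restrict_Ioo_mono hw.2 hk hl) (hint.mono_set hsub)
      (hintp.mono_set hsub)).ge (hC k l hk hkl hl)
  · exact setAverage_Ioo_pos hαβ hp1 (hint'.mono_set hsub')
  · exact setAverage_Ioo_pos hαβ (hp1.mono fun t h => hpow h) (hintp'.mono_set hsub')

theorem le_powerConstant {p₁ p₂ k l : ℝ} (hk : a ≤ k) (hkl : k < l) (hl : l ≤ b) :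
    (⨍⁻ t in Ioo k l, ENNReal.ofReal (w t ^ p₁) ∂volume) ^ (1 / p₁) *
      (⨍⁻ t in Ioo k l, ENNReal.ofReal (w t ^ p₂) ∂volume) ^ (-1 / p₂) ≤ powerConstant p₁ p₂ a b w :=
  le_iSup₂_of_le k l (le_iSup_of_le ⟨hk, hkl, hl⟩ le_rfl)

theorem IsMonotoneRearrangement.muckenhouptConstant_le (hab : a < b) (hcd : c < d)
    (hR : IsMonotoneRearrangement a b w c d ws) (hw : IsWeight a b w) {p : ℝ} (hp : 1 < p) :
    muckenhouptConstant p c d ws ≤ muckenhouptConstant p a b w := by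
  unfold muckenhouptConstant
  set q := -1 / (p - 1) with hq
  have hq0 : q < 0 := div_neg_of_neg_of_pos (by norm_num) (by linarith)
  have hs : 0 < -1 / q := div_pos_of_neg_of_neg (by norm_num) hq0
  have hposq : ∀ᵐ t ∂volume.restrict (Ioo a b), 0 < w t ^ q :=
    hw.2.mono fun t h => Real.rpow_pos_of_pos h q
  have hI := le_powerConstant (w := w) (p₁ := 1) (p₂ := q) le_rfl hab le_rfl
  have hn1 := laverage_Ioo_ne_zero hab hw.1 hw.2
  have hn2 := laverage_Ioo_ne_zero hab (hw.1.pow_const q) hposq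
  simp only [Real.rpow_one, div_one] at hI
  -- If `w` or its power is not summable, the whole interval already makes the constant infinite:
  -- one factor is infinite and the other is not zero.
  by_cases hint : IntegrableOn w (Ioo a b)
  swap
  · rw [laverage_Ioo_eq_top hw.1 hw.2 hint, ENNReal.rpow_one, ENNReal.top_mul, top_le_iff] at hI
    · rw [hI]; exact le_top
    · intro h
      rcases ENNReal.rpow_eq_zero_iff.1 h with h | h
      · exact hn2 h.1
      · linarith
  by_cases hintq : IntegrableOn (fun t => w t ^ q) (Ioo a b)
  swap
  · rw [laverage_Ioo_eq_top (hw.1.pow_const q) hposq hintq, ENNReal.top_rpow_of_pos hs,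
      ENNReal.rpow_one, ENNReal.mul_top hn1, top_le_iff] at hI
    rw [hI]; exact le_top
  refine iSup₂_le fun α β => iSup_le fun h => ?_
  simp only [Real.rpow_one]
  refine hR.average_rpow_le hab hcd hw (convexOn_rpow_of_nonpos hq0.le) hs.le hint hintq
    (fun k l hk hkl hl => ?_) h.1 h.2.1 h.2.2
  simpa only [Real.rpow_one] using le_powerConstant (w := w) (p₁ := 1) (p₂ := q) hk hkl hl

theorem IsMonotoneRearrangement.gehringConstant_le (hab : a < b) (hcd : c < d)
    (hR : IsMonotoneRearrangement a b w c d ws) (hw : IsWeight a b w)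
    (hint : IntegrableOn w (Ioo a b)) {q : ℝ} (hq : 1 < q) :
    gehringConstant q c d ws ≤ gehringConstant q a b w := by
  unfold gehringConstant
  have hs : 0 < 1 / q := by positivity
  have hposq : ∀ᵐ t ∂volume.restrict (Ioo a b), 0 < w t ^ q :=
    hw.2.mono fun t h => Real.rpow_pos_of_pos h q
  by_cases hintq : IntegrableOn (fun t => w t ^ q) (Ioo a b)
  swap
  · have hI := le_powerConstant (w := w) (p₁ := q) (p₂ := 1) le_rfl hab le_rfl
    simp only [Real.rpow_one, div_one] at hI
    rw [laverage_Ioo_eq_top (hw.1.pow_const q) hposq hintq, ENNReal.top_rpow_of_pos hs,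
      ENNReal.top_mul, top_le_iff] at hI
    · rw [hI]; exact le_top
    · rw [laverage_Ioo_eq_ofReal hw.2 hint, ENNReal.ofReal_rpow_of_pos
        (setAverage_Ioo_pos hab hw.2 hint)]
      have := setAverage_Ioo_pos hab hw.2 hint
      simp only [ne_eq, ENNReal.ofReal_eq_zero, not_le]
      positivity
  refine iSup₂_le fun α β => iSup_le fun h => ?_
  simp only [Real.rpow_one]
  -- The factors are swapped so that the plain average comes first. Its exponent may be negative;
  -- only that of the convex power must be nonnegative.
  rw [mul_comm]
  refine hR.average_rpow_le hab hcd hw ((convexOn_rpow hq.le).subset Ioi_subset_Ici_self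
    (convex_Ioi 0)) hs.le hint hintq (fun k l hk hkl hl => ?_) h.1 h.2.1 h.2.2
  rw [mul_comm]
  simpa only [Real.rpow_one] using le_powerConstant (w := w) (p₁ := q) (p₂ := 1) hk hkl hl

theorem IsMonotoneRearrangement.muckenhouptConstantTop_le (hab : a < b) (hcd : c < d)
    (hR : IsMonotoneRearrangement a b w c d ws) (hw : IsWeight a b w)
    (hint : IntegrableOn w (Ioo a b)) (hlog : IntegrableOn (fun t => Real.log (w t)) (Ioo a b)) :
    muckenhouptConstantTop c d ws ≤ muckenhouptConstantTop a b w := by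
  refine iSup₂_le fun α β => iSup_le fun h => ?_
  set C := muckenhouptConstantTop a b w with hCdef
  by_cases hCtop : C = ∞
  · simp [hCtop]
  have hpos' : ∀ᵐ t ∂volume.restrict (Ioo c d), 0 < ws t := hR.ae_mem measurableSet_Ioi hw.2
  have hint' := hR.integrableOn_comp hab hcd measurable_id hint
  have hneg : ∀ (u : ℝ → ℝ) (k l : ℝ), -⨍ t in Ioo k l, Real.log (u t) =
      ⨍ t in Ioo k l, -Real.log (u t) := fun u k l => (average_neg _ _).symm
  simp only [hneg]
  rw [ENNReal.ofReal_le_iff_le_toReal hCtop]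
  refine hR.apply_average_le hab hcd (h := fun x => -Real.log x)
    strictConcaveOn_log_Ioi.concaveOn.neg Real.measurable_log.neg measurableSet_Ioi hw.2 hint
    hlog.neg (W := Ioi 0 ×ˢ univ) (isOpen_Ioi.prod isOpen_univ) (fun x y y' h hy => ⟨h.1, trivial⟩)
    (Φ := fun z => z.1 * Real.exp z.2) (by fun_prop) ?_
    (fun k l hk hkl hl => ?_) h.1 h.2.1 h.2.2 ⟨?_, trivial⟩
  · rintro x y y' ⟨hx, hy⟩ hyy'
    have hx : 0 < x := hx
    dsimp only
    gcongr
  · rw [← ENNReal.ofReal_le_iff_le_toReal hCtop]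
    dsimp only
    rw [← hneg, hCdef]
    exact le_iSup₂_of_le k l (le_iSup_of_le ⟨hk, hkl, hl⟩ le_rfl)
  · exact setAverage_Ioo_pos h.2.1 (ae_restrict_Ioo_mono hpos' h.1 h.2.2)
      (hint'.mono_set (Ioo_subset_Ioo h.1 h.2.2))

/-- The essential infimum is not an average, but for a summable weight it lies below `B` exactly
when `max (B - w) 0` has positive average. This function is convex in `w`, so the comparison applies
for each `B` above the essential infimum `e` of `ws`; then `B` decreases to `e`. -/
theorem IsMonotoneRearrangement.muckenhouptConstantOne_le (hab : a < b) (hcd : c < d)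
    (hR : IsMonotoneRearrangement a b w c d ws) (hw : IsWeight a b w) :
    muckenhouptConstantOne c d ws ≤ muckenhouptConstantOne a b w := by
  set C := muckenhouptConstantOne a b w with hCdef
  by_cases hCtop : C = ∞
  · simp [hCtop]
  have hle : ∀ k l, a ≤ k → k < l → l ≤ b → (⨍⁻ t in Ioo k l, ENNReal.ofReal (w t) ∂volume) *
      (essInf (fun t => ENNReal.ofReal (w t)) (volume.restrict (Ioo k l)))⁻¹ ≤ C :=
    fun k l hk hkl hl => le_iSup₂_of_le k l (le_iSup_of_le ⟨hk, hkl, hl⟩ le_rfl)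
  have hint : IntegrableOn w (Ioo a b) := by
    by_contra hint
    have := hle a b le_rfl hab le_rfl
    rw [laverage_Ioo_eq_top hw.1 hw.2 hint, ENNReal.top_mul, top_le_iff] at this
    · exact hCtop this
    rw [ENNReal.inv_ne_zero]
    intro htop
    have hae := ae_essInf_le (f := fun t => ENNReal.ofReal (w t)) (μ := volume.restrict (Ioo a b))
    rw [htop] at hae
    have h3 : ∀ᵐ t ∂volume.restrict (Ioo a b), False :=
      hae.mono fun t ht => ENNReal.ofReal_ne_top (top_le_iff.1 ht)
    simp only [eventually_false_iff_eq_bot, ae_eq_bot, Measure.restrict_eq_zero,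
      Real.volume_Ioo, ENNReal.ofReal_eq_zero] at h3
    linarith
  have hpos' : ∀ᵐ t ∂volume.restrict (Ioo c d), 0 < ws t := hR.ae_mem measurableSet_Ioi hw.2
  have hint' := hR.integrableOn_comp hab hcd measurable_id hint
  refine iSup₂_le fun α β => iSup_le fun hαβ => ?_
  set e := essInf (fun t => ENNReal.ofReal (ws t)) (volume.restrict (Ioo α β)) with he
  rw [← div_eq_mul_inv]
  apply ENNReal.div_le_of_le_mul
  rw [laverage_Ioo_eq_ofReal (ae_restrict_Ioo_mono hpos' hαβ.1 hαβ.2.2)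
    (hint'.mono_set (Ioo_subset_Ioo hαβ.1 hαβ.2.2))]
  have key : ∀ B : ℝ, e < ENNReal.ofReal B →
      ENNReal.ofReal (⨍ t in Ioo α β, ws t) ≤ C * ENNReal.ofReal B := by
    intro B hB
    have hB0 : 0 < B := by
      by_contra! h
      simp [ENNReal.ofReal_eq_zero.2 h] at hB
    rw [← ENNReal.ofReal_toReal hCtop, ← ENNReal.ofReal_mul ENNReal.toReal_nonneg]
    apply ENNReal.ofReal_le_ofReal
    by_contra! hlt
    have hmeas : Measurable fun x : ℝ => max (B - x) 0 :=
      (measurable_const.sub measurable_id).max measurable_const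
    have hconv : ConvexOn ℝ univ fun x : ℝ => max (B - x) 0 := by
      refine ConvexOn.sup ⟨convex_univ, fun x _ y _ s t _ _ hst => ?_⟩
        (convexOn_const 0 convex_univ)
      simp only [smul_eq_mul]
      have : B = s * B + t * B := by rw [← add_mul, hst, one_mul]
      linarith
    have hhw : IntegrableOn (fun t => max (B - w t) 0) (Ioo a b) :=
      ((integrable_const B).sub hint).sup (integrable_zero _ _ _)
    have hhws : IntegrableOn (fun t => max (B - ws t) 0) (Ioo α β) :=
      (hR.integrableOn_comp hab hcd hmeas hhw).mono_set (Ioo_subset_Ioo hαβ.1 hαβ.2.2)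
    have hy : 0 < ⨍ t in Ioo α β, max (B - ws t) 0 := by
      rw [setAverage_Ioo_eq hαβ.2.1]
      have h1 : 0 < (β - α)⁻¹ := inv_pos.2 (sub_pos.2 hαβ.2.1)
      refine mul_pos h1 (lt_of_le_of_ne (integral_nonneg fun _ => le_max_right _ _) fun h0 => ?_)
      have h2 := (integral_eq_zero_iff_of_nonneg (fun t => le_max_right _ _) hhws).1 h0.symm
      refine hB.not_ge (le_essInf_of_ae_le _ ?_)
      filter_upwards [h2] with t ht
      exact ENNReal.ofReal_le_ofReal (sub_nonpos.1 (max_eq_right_iff.1 ht))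
    -- An interval found here has average of `w` above `C * B` and essential infimum at most `B`,
    -- against the definition of `C`.
    obtain ⟨k, l, hk, hkl, hl, hx, hpos⟩ := exists_interval_average_mem hab hcd hR.identDistrib
      hR.monotoneOn_or_antitoneOn hconv hmeas (by simp) hint hhw
      (U := Ioi (C.toReal * B) ×ˢ Ioi 0) (isOpen_Ioi.prod isOpen_Ioi)
      (fun x y y' h hy => ⟨h.1, lt_of_lt_of_le h.2 hy⟩) hαβ.1 hαβ.2.1 hαβ.2.2 ⟨hlt, hy⟩
    have hinf : essInf (fun t => ENNReal.ofReal (w t)) (volume.restrict (Ioo k l)) ≤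
        ENNReal.ofReal B := by
      by_contra! hcon
      have h0 : ∀ᵐ t ∂volume.restrict (Ioo k l), max (B - w t) 0 = 0 := by
        filter_upwards [ae_essInf_le (f := fun t => ENNReal.ofReal (w t))
          (μ := volume.restrict (Ioo k l))] with t ht
        have := (ENNReal.ofReal_lt_ofReal_iff_of_nonneg hB0.le).1 (hcon.trans_le ht)
        exact max_eq_right (by linarith)
      have hpos : 0 < ⨍ t in Ioo k l, max (B - w t) 0 := hpos
      rw [setAverage_Ioo_eq hkl, integral_congr_ae h0] at hpos
      simp at hpos
    have h1 := hle k l hk hkl hl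
    rw [laverage_Ioo_eq_ofReal (ae_restrict_Ioo_mono hw.2 hk hl)
      (hint.mono_set (Ioo_subset_Ioo hk hl))] at h1
    have h2 := (mul_le_mul_right (ENNReal.inv_le_inv.2 hinf) _).trans h1
    rw [← ENNReal.ofReal_inv_of_pos hB0, ← ENNReal.ofReal_mul' (by positivity),
      ENNReal.ofReal_le_iff_le_toReal hCtop, ← div_eq_mul_inv, div_le_iff₀ hB0] at h2
    exact h2.not_gt hx
  have hetop : e ≠ ∞ := by
    intro htop
    have hae := ae_essInf_le (f := fun t => ENNReal.ofReal (ws t)) (μ := volume.restrict (Ioo α β))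
    rw [← he, htop] at hae
    have h3 : ∀ᵐ t ∂volume.restrict (Ioo α β), False :=
      hae.mono fun t ht => ENNReal.ofReal_ne_top (top_le_iff.1 ht)
    simp only [eventually_false_iff_eq_bot, ae_eq_bot, Measure.restrict_eq_zero,
      Real.volume_Ioo, ENNReal.ofReal_eq_zero] at h3
    linarith
  have hlim : Tendsto (fun B => C * ENNReal.ofReal B) (𝓝[>] e.toReal) (𝓝 (C * e)) := by
    refine ENNReal.Tendsto.const_mul ?_ (Or.inr hCtop)
    have := (ENNReal.continuous_ofReal.tendsto e.toReal).mono_left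
      (nhdsWithin_le_nhds (s := Ioi e.toReal))
    rwa [ENNReal.ofReal_toReal hetop] at this
  refine ge_of_tendsto hlim (eventually_mem_nhdsWithin.mono fun B hB => key B ?_)
  rw [← ENNReal.ofReal_toReal hetop]
  exact (ENNReal.ofReal_lt_ofReal_iff_of_nonneg ENNReal.toReal_nonneg).2 hB

end Weights

end

/-! ### Plane convex geometry: the boundary as a convex graph. -/

theorem ContinuousOn.strictMonoOn_or_strictAntiOn_of_injOn {D : Set ℝ} (hD : D.OrdConnected)
    {π : ℝ → ℝ} (hc : ContinuousOn π D) (hi : InjOn π D) : StrictMonoOn π D ∨ StrictAntiOn π D := by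
  by_contra! hcon
  obtain ⟨h1, h2⟩ := hcon
  simp only [StrictMonoOn, StrictAntiOn, not_forall, not_lt] at h1 h2
  obtain ⟨x, hx, y, hy, hxy, hπ⟩ := h1
  obtain ⟨x', hx', y', hy', hxy', hπ'⟩ := h2
  have hl : min x x' ∈ D := by rcases min_choice x x' with h | h <;> rw [h] <;> assumption
  have hr : max y y' ∈ D := by rcases max_choice y y' with h | h <;> rw [h] <;> assumption
  -- One compact interval contains both counterexamples, so the result for compact intervals
  -- contradicts one of them.
  have hsub : Icc (min x x') (max y y') ⊆ D := hD.out hl hr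
  have mx : x ∈ Icc (min x x') (max y y') := ⟨min_le_left _ _, hxy.le.trans (le_max_left _ _)⟩
  have my : y ∈ Icc (min x x') (max y y') :=
    ⟨(min_le_left _ _).trans hxy.le, le_max_left _ _⟩
  have mx' : x' ∈ Icc (min x x') (max y y') :=
    ⟨min_le_right _ _, hxy'.le.trans (le_max_right _ _)⟩
  have my' : y' ∈ Icc (min x x') (max y y') :=
    ⟨(min_le_right _ _).trans hxy'.le, le_max_right _ _⟩
  rcases ContinuousOn.strictMonoOn_of_injOn_Icc' (mx.1.trans mx.2) (hc.mono hsub)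
    (hi.mono hsub) with h | h
  · exact (h mx my hxy).not_ge hπ
  · exact (h mx' my' hxy').not_ge hπ'

/-- The vector `u` rotated by a right angle. -/
def perp (u : Plane) : Plane := !₂[-u 1, u 0]

theorem sq_add_sq_of_norm_eq_one {u : Plane} (hu : ‖u‖ = 1) : u 0 ^ 2 + u 1 ^ 2 = 1 := by
  have h := EuclideanSpace.norm_sq_eq u
  rw [hu, Fin.sum_univ_two] at h
  simpa using h.symm

theorem inner_perp_frame {u : Plane} (hu : ‖u‖ = 1) (x y : ℝ) :
    inner ℝ (perp u) (x • perp u + y • u) = x := by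
  have h := sq_add_sq_of_norm_eq_one hu
  simp only [PiLp.inner_apply, Fin.sum_univ_two, perp, PiLp.add_apply, PiLp.smul_apply, smul_eq_mul,
    RCLike.inner_apply, conj_trivial, Matrix.cons_val_zero, Matrix.cons_val_one]
  linear_combination x * h

theorem inner_frame {u : Plane} (hu : ‖u‖ = 1) (x y : ℝ) :
    inner ℝ u (x • perp u + y • u) = y := by
  have h := sq_add_sq_of_norm_eq_one hu
  simp only [PiLp.inner_apply, Fin.sum_univ_two, perp, PiLp.add_apply, PiLp.smul_apply, smul_eq_mul,
    RCLike.inner_apply, conj_trivial, Matrix.cons_val_zero, Matrix.cons_val_one]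
  linear_combination y * h

theorem frame_inner {u : Plane} (hu : ‖u‖ = 1) (p : Plane) :
    (inner ℝ (perp u) p : ℝ) • perp u + (inner ℝ u p : ℝ) • u = p := by
  have h := sq_add_sq_of_norm_eq_one hu
  ext i
  simp only [PiLp.inner_apply, Fin.sum_univ_two, perp, PiLp.add_apply, PiLp.smul_apply, smul_eq_mul,
    RCLike.inner_apply, conj_trivial, Matrix.cons_val_zero, Matrix.cons_val_one]
  fin_cases i
  · simp only [Fin.zero_eta, Matrix.cons_val_zero]
    linear_combination p 0 * h
  · simp only [Fin.mk_one, Matrix.cons_val_one, Matrix.cons_val_zero]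
    linear_combination p 1 * h

/-- The shadow of a set in the direction `u`. -/
def shadow (Ω : Set Plane) (u : Plane) : Set ℝ := {x | ∃ y : ℝ, x • perp u + y • u ∈ Ω}

open Classical in
/-- The function on the shadow whose graph bounds a set closed under translations by `u`. -/
def lowerEnvelope (Ω : Set Plane) (u : Plane) (x : ℝ) : ℝ :=
  if x ∈ shadow Ω u then sInf {y : ℝ | x • perp u + y • u ∈ Ω} else 0

section Graph

variable {Ω : Set Plane} {u : Plane}

theorem isOpen_shadow (hΩ : IsOpen Ω) : IsOpen (shadow Ω u) := by
  have : shadow Ω u = ⋃ y : ℝ, (fun x : ℝ => x • perp u + y • u) ⁻¹' Ω := by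
    ext x; simp [shadow]
  rw [this]
  exact isOpen_iUnion fun y => hΩ.preimage (by fun_prop)

/-- Each section along `u` is open and closed upwards, hence an open ray unless it is empty or a
full line, and lines are excluded. -/
theorem mem_iff_lowerEnvelope_lt (hΩ : IsOpen Ω) (hu0 : u ≠ 0)
    (hline : ∀ x u : Plane, u ≠ 0 → ¬ ∀ t : ℝ, x + t • u ∈ Ω)
    (hrec : ∀ p ∈ Ω, ∀ s : ℝ, 0 ≤ s → p + s • u ∈ Ω) (x y : ℝ) :
    x • perp u + y • u ∈ Ω ↔ x ∈ shadow Ω u ∧ lowerEnvelope Ω u x < y := by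
  set S : Set ℝ := {y : ℝ | x • perp u + y • u ∈ Ω} with hS
  have hup : ∀ y ∈ S, ∀ z, y ≤ z → z ∈ S := by
    intro y hy z hyz
    have h := hrec _ hy (z - y) (sub_nonneg.2 hyz)
    rwa [add_assoc, ← add_smul, add_sub_cancel] at h
  have hSo : IsOpen S := hΩ.preimage (by fun_prop : Continuous fun y : ℝ => x • perp u + y • u)
  have hbdd : BddBelow S := by
    by_contra hb
    refine hline (x • perp u) u hu0 fun t => ?_
    obtain ⟨y, hy, hyt⟩ := not_bddBelow_iff.1 hb t
    exact hup y hy t hyt.le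
  constructor
  · intro h
    have hx : x ∈ shadow Ω u := ⟨y, h⟩
    refine ⟨hx, ?_⟩
    rw [lowerEnvelope, if_pos hx]
    obtain ⟨z, hz, hzS⟩ : ∃ z < y, z ∈ S := by
      have : ∀ᶠ z in 𝓝[<] y, z ∈ S := nhdsWithin_le_nhds (hSo.mem_nhds h)
      obtain ⟨z, hz⟩ := (this.and self_mem_nhdsWithin).exists
      exact ⟨z, hz.2, hz.1⟩
    exact (csInf_le hbdd hzS).trans_lt hz
  · rintro ⟨hx, hlt⟩
    rw [lowerEnvelope, if_pos hx] at hlt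
    obtain ⟨z, hz, hzy⟩ := exists_lt_of_csInf_lt hx hlt
    exact hup z hz y hzy.le

theorem convexOn_lowerEnvelope (hΩ : IsOpen Ω) (hconv : Convex ℝ Ω) (hu0 : u ≠ 0)
    (hline : ∀ x u : Plane, u ≠ 0 → ¬ ∀ t : ℝ, x + t • u ∈ Ω)
    (hrec : ∀ p ∈ Ω, ∀ s : ℝ, 0 ≤ s → p + s • u ∈ Ω) :
    ConvexOn ℝ (shadow Ω u) (lowerEnvelope Ω u) := by
  have hmem := mem_iff_lowerEnvelope_lt hΩ hu0 hline hrec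
  have key : ∀ x₁ y₁ x₂ y₂ s t : ℝ, x₁ • perp u + y₁ • u ∈ Ω → x₂ • perp u + y₂ • u ∈ Ω →
      0 ≤ s → 0 ≤ t → s + t = 1 →
      (s * x₁ + t * x₂) • perp u + (s * y₁ + t * y₂) • u ∈ Ω := by
    intro x₁ y₁ x₂ y₂ s t h1 h2 hs ht hst
    convert hconv h1 h2 hs ht hst using 1
    module
  refine ⟨fun x₁ ⟨y₁, h₁⟩ x₂ ⟨y₂, h₂⟩ s t hs ht hst => ⟨_, key _ _ _ _ s t h₁ h₂ hs ht hst⟩, ?_⟩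
  intro x₁ h₁ x₂ h₂ s t hs ht hst
  simp only [smul_eq_mul]
  -- Graph points do not belong to the open set, so both are lifted by `ε` first.
  refine le_of_forall_pos_le_add fun ε hε => ?_
  have h3 := key _ _ _ _ s t ((hmem x₁ (lowerEnvelope Ω u x₁ + ε)).2 ⟨h₁, by linarith⟩)
    ((hmem x₂ (lowerEnvelope Ω u x₂ + ε)).2 ⟨h₂, by linarith⟩) hs ht hst
  have h4 := ((hmem _ _).1 h3).2
  have : s * ε + t * ε = ε := by rw [← add_mul, hst, one_mul]
  linarith

/-- The value `0` off the shadow matters here: composing with equidistributed functions requires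
measurability on the whole line. -/
theorem measurable_lowerEnvelope (hΩ : IsOpen Ω)
    (hconv : ConvexOn ℝ (shadow Ω u) (lowerEnvelope Ω u)) : Measurable (lowerEnvelope Ω u) := by
  classical
  have hD := isOpen_shadow (u := u) hΩ
  have h : (shadow Ω u).piecewise (lowerEnvelope Ω u) (fun _ => 0) = lowerEnvelope Ω u := by
    ext x
    by_cases hx : x ∈ shadow Ω u <;> simp [hx, lowerEnvelope]
  rw [← h]
  exact (hconv.continuousOn hD).measurable_piecewise continuousOn_const hD.measurableSet

theorem mem_frontier_iff_eq_lowerEnvelope (hΩ : IsOpen Ω) (hconv : Convex ℝ Ω)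
    (hu : ‖u‖ = 1) (hline : ∀ x u : Plane, u ≠ 0 → ¬ ∀ t : ℝ, x + t • u ∈ Ω)
    (hcone : u ∈ asymptoticCone ℝ Ω)
    (hseg : ∀ x y : Plane, x ≠ y → ¬ segment ℝ x y ⊆ frontier Ω) (p : Plane) :
    p ∈ frontier Ω ↔ inner ℝ (perp u) p ∈ shadow Ω u ∧
      inner ℝ u p = lowerEnvelope Ω u (inner ℝ (perp u) p) := by
  have hu0 : u ≠ 0 := by rintro rfl; simp at hu
  have hrec : ∀ p ∈ Ω, ∀ s : ℝ, 0 ≤ s → p + s • u ∈ Ω := fun p hp s hs => by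
    have := hconv.smul_vadd_mem_of_mem_nhds_of_mem_asymptoticCone hs (hΩ.mem_nhds hp) hcone
    rwa [vadd_eq_add, add_comm] at this
  have hmem := mem_iff_lowerEnvelope_lt hΩ hu0 hline hrec
  set x : ℝ := inner ℝ (perp u) p with hx
  set y : ℝ := inner ℝ u p with hy
  have hp : x • perp u + y • u = p := frame_inner hu p
  rw [hΩ.frontier_eq, Set.mem_sdiff]
  constructor
  · rintro ⟨hcl, hnot⟩
    -- A boundary point above no point of the shadow would carry a vertical ray of the boundary,
    -- hence a segment.
    have hxD : x ∈ shadow Ω u := by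
      by_contra hxD
      refine hseg p (p + u) (by simpa using hu0) fun q hq => ?_
      rw [segment_eq_image'] at hq
      obtain ⟨s, hs, rfl⟩ := hq
      rw [hΩ.frontier_eq, add_sub_cancel_left]
      constructor
      · have := hconv.closure.smul_vadd_mem_of_isClosed_of_mem_asymptoticCone isClosed_closure hs.1
          (by rwa [asymptoticCone_closure]) hcl
        rwa [vadd_eq_add, add_comm] at this
      · intro h
        refine hxD ⟨y + s, ?_⟩
        have h : p + s • u ∈ Ω := h
        have h : p + s • u ∈ Ω := h
        rwa [← hp, add_assoc, ← add_smul] at h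
    refine ⟨hxD, le_antisymm ?_ ?_⟩
    · by_contra! h
      exact hnot (hp ▸ (hmem x y).2 ⟨hxD, h⟩)
    · by_contra! h
      -- Reflecting a closure point below the graph in the graph point gives an interior point, and
      -- the midpoint, lying on the graph, would be interior too.
      have h2 : x • perp u + (2 * lowerEnvelope Ω u x - y) • u ∈ interior Ω := by
        rw [hΩ.interior_eq]; exact (hmem _ _).2 ⟨hxD, by linarith⟩
      have h3 := hconv.openSegment_closure_interior_subset_interior hcl h2
        (show x • perp u + lowerEnvelope Ω u x • u ∈ _ from
          ⟨1 / 2, 1 / 2, by norm_num, by norm_num, by norm_num, by rw [← hp]; module⟩)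
      rw [hΩ.interior_eq] at h3
      exact ((hmem _ _).1 h3).2.false
  · rintro ⟨hxD, hxy⟩
    refine ⟨?_, fun h => ?_⟩
    · have hlim : Tendsto (fun s : ℝ => x • perp u + s • u) (𝓝[>] y) (𝓝 p) := by
        rw [← hp]
        exact tendsto_nhdsWithin_of_tendsto_nhds (Continuous.tendsto' (by fun_prop) _ _ rfl)
      refine mem_closure_of_tendsto hlim (eventually_mem_nhdsWithin.mono fun s hs => ?_)
      exact (hmem x s).2 ⟨hxD, hxy ▸ hs⟩
    · rw [← hp] at h
      exact ((hmem x y).1 h).2.ne' hxy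

end Graph

/-- The boundary of `Ω₀` is the graph of a convex function on an open interval, in coordinates
whose second axis is a recession direction of both `Ω₀` and `Ω₁`. -/
theorem exists_graph_coordinates {Ω₀ Ω₁ : Set Plane} (hP : IsConvexPair Ω₀ Ω₁)
    (hS : NoSegmentCondition Ω₀ Ω₁) (hR : RayCondition Ω₀ Ω₁) :
    ∃ (u : Plane) (D : Set ℝ) (h : ℝ → ℝ), ‖u‖ = 1 ∧ IsOpen D ∧ ConvexOn ℝ D h ∧ Measurable h ∧
      (∀ p, p ∈ frontier Ω₀ ↔ inner ℝ (perp u) p ∈ D ∧ inner ℝ u p = h (inner ℝ (perp u) p)) ∧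
      ∀ p ∈ Ω₁, ∀ s : ℝ, 0 ≤ s → p + s • u ∈ Ω₁ := by
  obtain ⟨u', hu', hcone'⟩ := not_bounded_iff_exists_ne_zero_mem_asymptoticCone.1 hR.1
  have hn : 0 < ‖u'‖ := norm_pos_iff.2 hu'
  set u : Plane := ‖u'‖⁻¹ • u' with hudef
  have hu : ‖u‖ = 1 := norm_smul_inv_norm hu'
  have hu0 : u ≠ 0 := by intro h; simp [h] at hu
  have hcone : u ∈ asymptoticCone ℝ Ω₀ := smul_mem_asymptoticCone (by positivity) hcone'
  have hrec : ∀ p ∈ Ω₀, ∀ s : ℝ, 0 ≤ s → p + s • u ∈ Ω₀ := fun p hp s hs => by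
    have := hP.convex_outer.smul_vadd_mem_of_mem_nhds_of_mem_asymptoticCone hs
      (hP.isOpen_outer.mem_nhds hp) hcone
    rwa [vadd_eq_add, add_comm] at this
  have hcx := convexOn_lowerEnvelope hP.isOpen_outer hP.convex_outer hu0 hP.no_line hrec
  refine ⟨u, shadow Ω₀ u, lowerEnvelope Ω₀ u, hu, isOpen_shadow hP.isOpen_outer, hcx,
    measurable_lowerEnvelope hP.isOpen_outer hcx, mem_frontier_iff_eq_lowerEnvelope hP.isOpen_outer
    hP.convex_outer hu hP.no_line hcone fun x y hxy => (hS x y hxy).1, ?_⟩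
  obtain ⟨p₀, hp₀⟩ := hP.nonempty
  obtain ⟨y, hy⟩ := hR.2 p₀ u hu0 (hrec p₀ hp₀)
  -- A single ray of direction `u` in `Ω₁` puts `u` in the asymptotic cone; convexity and openness
  -- then let every point of `Ω₁` move along `u`.
  have hcone₁ : u ∈ asymptoticCone ℝ Ω₁ := by
    rw [mem_asymptoticCone_iff]
    refine ((tendsto_id.atTop_smul_const_tendsto_asymptoticNhds u).asymptoticNhds_vadd_const
      y).frequently (Eventually.frequently ?_)
    filter_upwards [eventually_ge_atTop (0 : ℝ)] with t ht
    rw [vadd_eq_add, add_comm]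
    exact hy t ht
  intro p hp s hs
  have := hP.convex_inner.smul_vadd_mem_of_mem_nhds_of_mem_asymptoticCone hs
    (hP.isOpen_inner.mem_nhds hp) hcone₁
  rwa [vadd_eq_add, add_comm] at this

theorem setAverage_eq_frame {u : Plane} (hu : ‖u‖ = 1) {φ : ℝ → Plane} {h : ℝ → ℝ} {k l : ℝ}
    (hφ : IntegrableOn φ (Ioo k l)) (hgraph : ∀ᵐ t ∂volume.restrict (Ioo k l),
      inner ℝ u (φ t) = h (inner ℝ (perp u) (φ t))) :
    ⨍ t in Ioo k l, φ t = (⨍ t in Ioo k l, inner ℝ (perp u) (φ t)) • perp u +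
      (⨍ t in Ioo k l, h (inner ℝ (perp u) (φ t))) • u := by
  have h1 : ∀ e : Plane, ⨍ t in Ioo k l, inner ℝ e (φ t) = inner ℝ e (⨍ t in Ioo k l, φ t) := by
    intro e
    rw [setAverage_eq, setAverage_eq, integral_inner hφ, inner_smul_right, smul_eq_mul]
  have h2 : ⨍ t in Ioo k l, h (inner ℝ (perp u) (φ t)) = ⨍ t in Ioo k l, inner ℝ u (φ t) :=
    average_congr (hgraph.mono fun t ht => ht.symm)
  rw [h2, h1, h1, frame_inner hu]

/-! ### Rearrangements along the boundary curve. -/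

section Boundary

variable {Ω₀ Ω₁ : Set Plane} {u v : Plane} {D : Set ℝ} {h : ℝ → ℝ}

/-- Along the graph any admissible projection is a continuous injective function of the abscissa.
All admissible orders therefore agree with that of the abscissa up to reversal. -/
theorem strictMonoOn_or_strictAntiOn_of_isParametrizingDirection (hu : ‖u‖ = 1) (hD : IsOpen D)
    (hh : ConvexOn ℝ D h) (hfr : ∀ p, p ∈ frontier Ω₀ ↔
      inner ℝ (perp u) p ∈ D ∧ inner ℝ u p = h (inner ℝ (perp u) p))
    (hv : IsParametrizingDirection Ω₀ v) :
    StrictMonoOn (fun x : ℝ => (inner ℝ v (x • perp u + h x • u) : ℝ)) D ∨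
      StrictAntiOn (fun x : ℝ => (inner ℝ v (x • perp u + h x • u) : ℝ)) D := by
  refine ContinuousOn.strictMonoOn_or_strictAntiOn_of_injOn hh.1.ordConnected ?_ ?_
  · have := hh.continuousOn hD
    fun_prop
  · intro x hx y hy hxy
    have hmem : ∀ z ∈ D, z • perp u + h z • u ∈ frontier Ω₀ := fun z hz => by
      rw [hfr, inner_perp_frame hu, inner_frame hu]
      exact ⟨hz, rfl⟩
    have := congrArg (inner ℝ (perp u) : Plane → ℝ) (hv (hmem x hx) (hmem y hy) hxy)
    rwa [inner_perp_frame hu, inner_perp_frame hu] at this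

theorem isParametrizingDirection_perp (hu : ‖u‖ = 1) (hfr : ∀ p, p ∈ frontier Ω₀ ↔
      inner ℝ (perp u) p ∈ D ∧ inner ℝ u p = h (inner ℝ (perp u) p)) :
    IsParametrizingDirection Ω₀ (perp u) := by
  intro p hp q hq hpq
  dsimp only at hpq
  rw [← frame_inner hu p, ← frame_inner hu q, ((hfr p).1 hp).2, ((hfr q).1 hq).2, hpq]

variable {a b c d : ℝ} {φ φs : ℝ → Plane}

/-- The abscissa is rearranged, in the direction dictated by `v`, and the result is lifted to the
graph. -/
theorem exists_isBoundaryRearrangement (hab : a < b) (hcd : c < d) (hu : ‖u‖ = 1) (hD : IsOpen D)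
    (hh : ConvexOn ℝ D h) (hmeas : Measurable h) (hfr : ∀ p, p ∈ frontier Ω₀ ↔
      inner ℝ (perp u) p ∈ D ∧ inner ℝ u p = h (inner ℝ (perp u) p))
    (hv : IsParametrizingDirection Ω₀ v) (hφ : IntegrableOn φ (Ioo a b))
    (hφfr : ∀ᵐ t ∂volume.restrict (Ioo a b), φ t ∈ frontier Ω₀) :
    ∃ φs, IsBoundaryRearrangement Ω₀ v a b φ c d φs := by
  set f : ℝ → ℝ := fun t => inner ℝ (perp u) (φ t) with hf
  have hfm : AEMeasurable f (volume.restrict (Ioo a b)) := (hφ.const_inner (perp u)).aemeasurable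
  have hπ := strictMonoOn_or_strictAntiOn_of_isParametrizingDirection hu hD hh hfr hv
  obtain ⟨fs, hfs, hmono⟩ : ∃ fs, IsMonotoneRearrangement a b f c d fs ∧
      (MonotoneOn (fun x : ℝ => (inner ℝ v (x • perp u + h x • u) : ℝ)) D ∧ MonotoneOn fs (Ioo c d) ∨
       AntitoneOn (fun x : ℝ => (inner ℝ v (x • perp u + h x • u) : ℝ)) D ∧
        AntitoneOn fs (Ioo c d)) := by
    rcases hπ with hπ | hπ
    · obtain ⟨fs, hfs⟩ := exists_isNondecreasingRearrangement hab hcd hfm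
      exact ⟨fs, Or.inl hfs, Or.inl ⟨hπ.monotoneOn, hfs.monotoneOn⟩⟩
    · obtain ⟨fs, hfs⟩ := exists_isNonincreasingRearrangement hab hcd hfm
      exact ⟨fs, Or.inr hfs, Or.inr ⟨hπ.antitoneOn, fun s hs t ht hst =>
        neg_le_neg_iff.1 (hfs.monotoneOn hs ht hst)⟩⟩
  have hfD : ∀ᵐ t ∂volume.restrict (Ioo a b), f t ∈ D := hφfr.mono fun t ht => ((hfr _).1 ht).1
  have hfsD : ∀ t ∈ Ioo c d, fs t ∈ D := fun t ht =>
    mem_of_monotoneOn_or_antitoneOn hfs.monotoneOn_or_antitoneOn hh.1.ordConnected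
      (hfs.ae_mem hD.measurableSet hfD) ht
  refine ⟨fun t => fs t • perp u + h (fs t) • u, fun t ht => ?_, ?_, ?_⟩
  · rw [hfr, inner_perp_frame hu, inner_frame hu]
    exact ⟨hfsD t ht, rfl⟩
  · rcases hmono with ⟨h1, h2⟩ | ⟨h1, h2⟩
    · exact fun s hs t ht hst => h1 (hfsD s hs) (hfsD t ht) (h2 hs ht hst)
    · exact fun s hs t ht hst => h1 (hfsD t ht) (hfsD s hs) (h2 hs ht hst)
  · have hΓ : Measurable fun x : ℝ => x • perp u + h x • u := by fun_prop
    have h1 := hfs.identDistrib.comp hΓ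
    refine h1.trans (IdentDistrib.of_ae_eq h1.aemeasurable_snd ?_)
    refine ae_cond_Ioo_iff.2 (hφfr.mono fun t ht => ?_)
    have := frame_inner hu (φ t)
    rwa [((hfr _).1 ht).2] at this

theorem IsBoundaryRearrangement.mem_analyticClass (hab : a < b) (hcd : c < d) (hΩ₁ : IsOpen Ω₁)
    (hrec : ∀ p ∈ Ω₁, ∀ s : ℝ, 0 ≤ s → p + s • u ∈ Ω₁) (hu : ‖u‖ = 1) (hD : IsOpen D)
    (hh : ConvexOn ℝ D h) (hmeas : Measurable h) (hfr : ∀ p, p ∈ frontier Ω₀ ↔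
      inner ℝ (perp u) p ∈ D ∧ inner ℝ u p = h (inner ℝ (perp u) p))
    (hv : IsParametrizingDirection Ω₀ v) (hφ : φ ∈ analyticClass Ω₀ Ω₁ a b)
    (hφs : IsBoundaryRearrangement Ω₀ v a b φ c d φs) : φs ∈ analyticClass Ω₀ Ω₁ c d := by
  obtain ⟨hφi, hφfr, hφavg⟩ := hφ
  have hφsi : IntegrableOn φs (Ioo c d) := (integrable_cond_Ioo_iff hcd).1
    (hφs.identDistrib.integrable_iff.2 ((integrable_cond_Ioo_iff hab).2 hφi))
  have hφsfr : ∀ᵐ t ∂volume.restrict (Ioo c d), φs t ∈ frontier Ω₀ :=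
    (ae_restrict_iff' measurableSet_Ioo).2 (ae_of_all _ hφs.mapsTo)
  refine ⟨hφsi, hφsfr, fun α β hα hαβ hβ hmem => ?_⟩
  have hgr : ∀ᵐ t ∂volume.restrict (Ioo a b), inner ℝ u (φ t) = h (inner ℝ (perp u) (φ t)) :=
    hφfr.mono fun t ht => ((hfr _).1 ht).2
  have hgrs : ∀ᵐ t ∂volume.restrict (Ioo c d), inner ℝ u (φs t) = h (inner ℝ (perp u) (φs t)) :=
    hφsfr.mono fun t ht => ((hfr _).1 ht).2
  have hmono : MonotoneOn (fun t => (inner ℝ (perp u) (φs t) : ℝ)) (Ioo c d) ∨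
      AntitoneOn (fun t => (inner ℝ (perp u) (φs t) : ℝ)) (Ioo c d) := by
    have hmemD : ∀ t ∈ Ioo c d, inner ℝ (perp u) (φs t) ∈ D := fun t ht =>
      ((hfr _).1 (hφs.mapsTo ht)).1
    have heq : ∀ t ∈ Ioo c d, (inner ℝ (perp u) (φs t) : ℝ) • perp u +
        h (inner ℝ (perp u) (φs t)) • u = φs t := fun t ht => by
      have := frame_inner hu (φs t)
      rwa [((hfr _).1 (hφs.mapsTo ht)).2] at this
    rcases strictMonoOn_or_strictAntiOn_of_isParametrizingDirection hu hD hh hfr hv with hπ | hπ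
    · refine Or.inl fun s hs t ht hst => ?_
      have := hφs.monotoneOn hs ht hst
      dsimp only at this
      rw [← heq s hs, ← heq t ht] at this
      exact (hπ.le_iff_le (hmemD s hs) (hmemD t ht)).1 this
    · refine Or.inr fun s hs t ht hst => ?_
      have := hφs.monotoneOn hs ht hst
      dsimp only at this
      rw [← heq s hs, ← heq t ht] at this
      exact (hπ.le_iff_ge (hmemD s hs) (hmemD t ht)).1 this
  have hinner : Measurable fun p : Plane => (inner ℝ (perp u) p : ℝ) := by fun_prop
  -- The forbidden set is `Ω₁` in graph coordinates, where its invariance under translation along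
  -- `u` reads as upward closedness.
  obtain ⟨k, l, hk, hkl, hl, hkl'⟩ := exists_interval_average_mem hab hcd
    (hφs.identDistrib.comp hinner) hmono hh hmeas
    (hφsfr.mono fun t ht => ((hfr _).1 ht).1) (hφi.const_inner (perp u))
    ((hφi.const_inner u).congr hgr) (U := (fun z : ℝ × ℝ => z.1 • perp u + z.2 • u) ⁻¹' Ω₁)
    (hΩ₁.preimage (by fun_prop))
    (fun x y y' hxy hy => by
      have := hrec _ hxy (y' - y) (sub_nonneg.2 hy)
      rwa [add_assoc, ← add_smul, add_sub_cancel] at this) hα hαβ hβ (by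
      rw [setAverage_eq_frame hu (hφsi.mono_set (Ioo_subset_Ioo hα hβ))
        (ae_restrict_Ioo_mono hgrs hα hβ)] at hmem
      exact hmem)
  refine hφavg k l hk hkl hl ?_
  rw [setAverage_eq_frame hu (hφi.mono_set (Ioo_subset_Ioo hk hl)) (ae_restrict_Ioo_mono hgr hk hl)]
  exact hkl'

end Boundary

end

theorem mainTheorem3 :
    -- rearrangements in the class of a domain
    (∀ Ω₀ Ω₁ : Set Plane, IsConvexPair Ω₀ Ω₁ → NoSegmentCondition Ω₀ Ω₁ → RayCondition Ω₀ Ω₁ →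
      (∃ v : Plane, IsParametrizingDirection Ω₀ v) ∧
      ∀ v : Plane, IsParametrizingDirection Ω₀ v →
      ∀ a b c d : ℝ, a < b → c < d →
      ∀ φ ∈ analyticClass Ω₀ Ω₁ a b,
        (∃ φs : ℝ → Plane, IsBoundaryRearrangement Ω₀ v a b φ c d φs) ∧
        ∀ φs : ℝ → Plane, IsBoundaryRearrangement Ω₀ v a b φ c d φs →
          φs ∈ analyticClass Ω₀ Ω₁ c d) ∧
    -- particular cases
    (∀ a b c d : ℝ, a < b → c < d →
      -- existence of the rearrangements of a real function
      (∀ ψ : ℝ → ℝ, AEMeasurable ψ (volume.restrict (Ioo a b)) →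
        (∃ ψs : ℝ → ℝ, IsNondecreasingRearrangement a b ψ c d ψs) ∧
        (∃ ψs : ℝ → ℝ, IsNonincreasingRearrangement a b ψ c d ψs)) ∧
      -- balls of BMO
      (∀ ε : ℝ, 0 < ε → ∀ ψ ∈ bmoBall ε a b, ∀ ψs : ℝ → ℝ,
        IsMonotoneRearrangement a b ψ c d ψs → ψs ∈ bmoBall ε c d) ∧
      -- Muckenhoupt constants: 1 < p < ∞, and the limiting cases p = 1 and p = ∞
      (∀ p : ℝ, 1 < p → ∀ w : ℝ → ℝ, IsWeight a b w → ∀ ws : ℝ → ℝ,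
        IsMonotoneRearrangement a b w c d ws →
          muckenhouptConstant p c d ws ≤ muckenhouptConstant p a b w) ∧
      (∀ w : ℝ → ℝ, IsWeight a b w → ∀ ws : ℝ → ℝ,
        IsMonotoneRearrangement a b w c d ws →
          muckenhouptConstantOne c d ws ≤ muckenhouptConstantOne a b w) ∧
      (∀ w : ℝ → ℝ, IsWeight a b w → IntegrableOn w (Ioo a b) →
        IntegrableOn (fun t => Real.log (w t)) (Ioo a b) → ∀ ws : ℝ → ℝ,
        IsMonotoneRearrangement a b w c d ws →
          muckenhouptConstantTop c d ws ≤ muckenhouptConstantTop a b w) ∧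
      -- Gehring constants
      (∀ q : ℝ, 1 < q → ∀ w : ℝ → ℝ, IsWeight a b w → IntegrableOn w (Ioo a b) →
        ∀ ws : ℝ → ℝ, IsMonotoneRearrangement a b w c d ws →
          gehringConstant q c d ws ≤ gehringConstant q a b w)) := by
  refine ⟨fun Ω₀ Ω₁ hP hS hR => ?_, fun a b c d hab hcd => ⟨fun ψ hψ =>
    ⟨exists_isNondecreasingRearrangement hab hcd hψ, exists_isNonincreasingRearrangement hab hcd hψ⟩,
    fun ε _ ψ hψ ψs hψs => hψs.mem_bmoBall hab hcd hψ,
    fun p hp w hw ws hws => hws.muckenhouptConstant_le hab hcd hw hp,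
    fun w hw ws hws => hws.muckenhouptConstantOne_le hab hcd hw,
    fun w hw hint hlog ws hws => hws.muckenhouptConstantTop_le hab hcd hw hint hlog,
    fun q hq w hw hint ws hws => hws.gehringConstant_le hab hcd hw hint hq⟩⟩
  obtain ⟨u, D, h, hu, hD, hh, hmeas, hfr, hrec⟩ := exists_graph_coordinates hP hS hR
  refine ⟨⟨perp u, isParametrizingDirection_perp hu hfr⟩, fun v hv a b c d hab hcd φ hφ =>
    ⟨exists_isBoundaryRearrangement hab hcd hu hD hh hmeas hfr hv hφ.1 hφ.2.1, fun φs hφs => ?_⟩⟩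
  exact hφs.mem_analyticClass hab hcd hP.isOpen_inner hrec hu hD hh hmeas hfr hv hφ
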